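/- **Proposition.** Realize $G_{5,3}$ as $\mathbb R^5$ with the multiplication $$x\cdot y=(x_1+y_1+x_4y_3+x_5y_2+\tfrac12x_5^2y_4,\;x_2+y_2+x_5y_4,\;x_3+y_3,\;x_4+y_4,\;x_5+y_5),$$ with center $\mathbb R\times\{(0,0,0,0)\}$, and $G_{6,19}$ as $\mathbb R^6$ with the multiplication $$x\cdot y=(x_1+y_1+x_6y_3,\;x_2+y_2+x_5y_4+x_5x_6y_5+\tfrac12x_6y_5^2,\;x_3+y_3,\;x_4+y_4+x_6y_5,\;x_5+y_5,\;x_6+y_6),$$ with center $\mathbb R^2\times\{(0,0,0,0)\}$. Let $\pi$ be the representation of $G_{5,3}$ on $L^2(\mathbb R^2)$ given by $$\pi(x)g(s,t)=e^{2\pi i(x_1-x_3x_4+x_4s-x_2t+\frac12x_4t^2)}\,g(s-x_3,t-x_5),$$ and for $\lambda,\mu\in\mathbb R$ with $\lambda\mu\ne0$ let $\pi_{\lambda,\mu}$ be the representation of $G_{6,19}$ on $L^2(\mathbb R^2)$ given by $$\pi_{\lambda,\mu}(x)g(s,t)=e^{2\pi i\left(\lambda(x_1-x_3t)+\mu(x_2-\frac12x_5^2x_6-x_4s+x_5x_6s-\frac12x_6s^2)\right)}\,g(s-x_5,t-x_6).$$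 Both act on $\mathcal S(\mathbb R^2)$ and, by duality, on $\mathcal S'(\mathbb R^2)$; $\langle f,\psi\rangle$ denotes the pairing of $f\in\mathcal S'(\mathbb R^2)$ and $\psi\in\mathcal S(\mathbb R^2)$ that is conjugate-linear in $\psi$ and extends the inner product of $L^2(\mathbb R^2)$. For $\rho=\pi$ on $G=G_{5,3}$ or $\rho=\pi_{\lambda,\mu}$ on $G=G_{6,19}$, with center $Z$, a window $0\neq g\in\mathcal S(\mathbb R^2)$ and $1\le r\le\infty$, let $$Co_\rho L^r(G/Z)=\{f\in\mathcal S'(\mathbb R^2):\ V_g^\rho f\in L^r(G/Z)\},\qquad \|f\|_{Co_\rho L^r}=\|V^\rho_gf\|_{L^r(G/Z)},\qquad V_g^\rho f(\dot x)=\langle f,\rho(\dot x)g\rangle,$$ where $G/Z$ is identified with $\mathbb R^4$, carrying Lebesgue measure, through the section $\dot x=(0,x_2,x_3,x_4,x_5)$, respectively $\dot x=(0,0,x_3,x_4,x_5,x_6)$. Let $M^r(\mathbb R^2)$ be the modulation space of all $f\in\mathcal S'(\mathbb R^2)$ such that $(x,\xi)\mapsto\langle f,M_\xi T_xg\rangle$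 belongs to $L^r(\mathbb R^4)$, where $M_\xi T_xg(t)=e^{2\pi i\xi\cdot t}g(t-x)$. Let $\lambda\mu\ne0$ and $p,q\in[1,\infty]$ with $p\neq2$. Then, for all choices of the non-zero Schwartz windows (possibly different for different spaces): (i) $Co_{\pi_{\lambda,\mu}}L^p(G_{6,19}/Z)\ne M^q(\mathbb R^2)$. (ii) $Co_{\pi_{\lambda,\mu}}L^p(G_{6,19}/Z)\ne Co_\pi L^q(G_{5,3}/Z)$. Moreover, each operator $\pi(0,0,0,u,0)$, $u\in\mathbb R$, maps $Co_\pi L^q(G_{5,3}/Z)$ into itself and preserves its norm, whereas for the Gaussian $(\phi\otimes\phi)(s,t)=e^{-\pi(s^2+t^2)}$ the orbit $\pi(0,0,0,u,0)(\phi\otimes\phi)$ lies in $Co_{\pi_{\lambda,\mu}}L^p(G_{6,19}/Z)$ and there is a constant $C>0$, independent of $u$, such that for all $u\in\mathbb R$ $$C^{-1}(1+u^2)^{\frac1{2p}-\frac14}\le\|\pi(0,0,0,u,0)(\phi\otimes\phi)\|_{Co_{\pi_{\lambda,\mu}}L^p(G_{6,19}/Z)}\le C(1+u^2)^{\frac1{2p}-\frac14},$$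 where $\frac1{2p}=0$ if $p=\infty$. -/

import Mathlib

open MeasureTheory SchwartzMap
open scoped SchwartzMap ENNReal

noncomputable section

namespace Coorbit

/-! ### The two nilpotent groups -/

/-- The nilpotent Lie group `G_{5,3}`, as `ℝ⁵` in coordinates `(x₁, …, x₅)`. -/
@[ext]
structure G53 where
  (x1 x2 x3 x4 x5 : ℝ)

namespace G53

instance : Mul G53 where
  mul x y :=
    ⟨x.x1 + y.x1 + x.x4 * y.x3 + x.x5 * y.x2 + 1 / 2 * x.x5 ^ 2 * y.x4,
      x.x2 + y.x2 + x.x5 * y.x4, x.x3 + y.x3, x.x4 + y.x4, x.x5 + y.x5⟩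

instance : One G53 where
  one := ⟨0, 0, 0, 0, 0⟩

instance : Inv G53 where
  inv x :=
    ⟨-x.x1 + x.x4 * x.x3 + x.x5 * x.x2 - 1 / 2 * x.x5 ^ 2 * x.x4,
      -x.x2 + x.x5 * x.x4, -x.x3, -x.x4, -x.x5⟩

lemma mul_def (x y : G53) : x * y =
    ⟨x.x1 + y.x1 + x.x4 * y.x3 + x.x5 * y.x2 + 1 / 2 * x.x5 ^ 2 * y.x4,
      x.x2 + y.x2 + x.x5 * y.x4, x.x3 + y.x3, x.x4 + y.x4, x.x5 + y.x5⟩ := rfl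

lemma one_def : (1 : G53) = ⟨0, 0, 0, 0, 0⟩ := rfl

lemma inv_def (x : G53) : x⁻¹ =
    ⟨-x.x1 + x.x4 * x.x3 + x.x5 * x.x2 - 1 / 2 * x.x5 ^ 2 * x.x4,
      -x.x2 + x.x5 * x.x4, -x.x3, -x.x4, -x.x5⟩ := rfl

instance : Group G53 :=
  Group.ofLeftAxioms
    (fun x y z => by ext <;> simp only [mul_def] <;> ring)
    (fun x => by ext <;> simp only [mul_def, one_def] <;> ring)
    (fun x => by ext <;> simp only [mul_def, inv_def, one_def] <;> ring)

lemma mem_center_iff (x : G53) :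
    x ∈ Subgroup.center G53 ↔ x.x2 = 0 ∧ x.x3 = 0 ∧ x.x4 = 0 ∧ x.x5 = 0 := by
  rw [Subgroup.mem_center_iff]
  constructor
  · intro h
    have h2 := congrArg G53.x1 (h ⟨0, 0, 0, 0, 1⟩)
    have h2' := congrArg G53.x2 (h ⟨0, 0, 0, 0, 1⟩)
    have h3 := congrArg G53.x1 (h ⟨0, 0, 0, 1, 0⟩)
    have h3' := congrArg G53.x2 (h ⟨0, 0, 0, 1, 0⟩)
    simp [mul_def] at h2 h2' h3 h3'
    simp only [h2', h3'] at h2 h3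
    simp at h2 h3
    exact ⟨h2, h3, h2', h3'⟩
  · rintro ⟨h2, h3, h4, h5⟩ y
    ext <;> simp [mul_def, h2, h3, h4, h5]
    ring

/-- The section `ẋ = (0, x₂, x₃, x₄, x₅)` of `G_{5,3} / Z`; Lebesgue measure on `ℝ⁴` is Haar measure
on the quotient in these coordinates. -/
def sec (y : ℝ × ℝ × ℝ × ℝ) : G53 := ⟨0, y.1, y.2.1, y.2.2.1, y.2.2.2⟩

end G53

/-- The nilpotent Lie group `G_{6,19}`, as `ℝ⁶` in coordinates `(x₁, …, x₆)`. -/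
@[ext]
structure G619 where
  (x1 x2 x3 x4 x5 x6 : ℝ)

namespace G619

instance : Mul G619 where
  mul x y :=
    ⟨x.x1 + y.x1 + x.x6 * y.x3,
      x.x2 + y.x2 + x.x5 * y.x4 + x.x5 * x.x6 * y.x5 + 1 / 2 * x.x6 * y.x5 ^ 2,
      x.x3 + y.x3, x.x4 + y.x4 + x.x6 * y.x5, x.x5 + y.x5, x.x6 + y.x6⟩

instance : One G619 where
  one := ⟨0, 0, 0, 0, 0, 0⟩

instance : Inv G619 where
  inv x :=
    ⟨-x.x1 + x.x6 * x.x3,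
      -x.x2 + x.x5 * x.x4 - 1 / 2 * x.x6 * x.x5 ^ 2,
      -x.x3, -x.x4 + x.x6 * x.x5, -x.x5, -x.x6⟩

lemma mul_def (x y : G619) : x * y =
    ⟨x.x1 + y.x1 + x.x6 * y.x3,
      x.x2 + y.x2 + x.x5 * y.x4 + x.x5 * x.x6 * y.x5 + 1 / 2 * x.x6 * y.x5 ^ 2,
      x.x3 + y.x3, x.x4 + y.x4 + x.x6 * y.x5, x.x5 + y.x5, x.x6 + y.x6⟩ := rfl

lemma one_def : (1 : G619) = ⟨0, 0, 0, 0, 0, 0⟩ := rfl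

lemma inv_def (x : G619) : x⁻¹ =
    ⟨-x.x1 + x.x6 * x.x3,
      -x.x2 + x.x5 * x.x4 - 1 / 2 * x.x6 * x.x5 ^ 2,
      -x.x3, -x.x4 + x.x6 * x.x5, -x.x5, -x.x6⟩ := rfl

instance : Group G619 :=
  Group.ofLeftAxioms
    (fun x y z => by ext <;> simp only [mul_def] <;> ring)
    (fun x => by ext <;> simp only [mul_def, one_def] <;> ring)
    (fun x => by ext <;> simp only [mul_def, inv_def, one_def] <;> ring)

lemma mem_center_iff (x : G619) :
    x ∈ Subgroup.center G619 ↔ x.x3 = 0 ∧ x.x4 = 0 ∧ x.x5 = 0 ∧ x.x6 = 0 := by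
  rw [Subgroup.mem_center_iff]
  constructor
  · intro h
    have h3 := congrArg G619.x1 (h ⟨0, 0, 0, 0, 0, 1⟩)
    have h5 := congrArg G619.x4 (h ⟨0, 0, 0, 0, 0, 1⟩)
    have h6 := congrArg G619.x1 (h ⟨0, 0, 1, 0, 0, 0⟩)
    have h4 := congrArg G619.x2 (h ⟨0, 0, 0, 0, 1, 0⟩)
    simp [mul_def] at h3 h4 h5 h6
    simp only [h5, h6] at h4
    simp at h4
    exact ⟨h3, h4, h5, h6⟩
  · rintro ⟨h3, h4, h5, h6⟩ y
    ext <;> simp [mul_def, h3, h4, h5, h6] <;> ring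

/-- The section `ẋ = (0, 0, x₃, x₄, x₅, x₆)` of `G_{6,19} / Z`; Lebesgue measure on `ℝ⁴` is Haar
measure on the quotient in these coordinates. -/
def sec (y : ℝ × ℝ × ℝ × ℝ) : G619 := ⟨0, 0, y.1, y.2.1, y.2.2.1, y.2.2.2⟩

end G619

/-! ### Operators on the Schwartz space -/

lemma growth_fst : Function.HasTemperateGrowth (fun z : ℝ × ℝ => z.1) :=
  (ContinuousLinearMap.fst ℝ ℝ ℝ).hasTemperateGrowth

lemma growth_snd : Function.HasTemperateGrowth (fun z : ℝ × ℝ => z.2) :=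
  (ContinuousLinearMap.snd ℝ ℝ ℝ).hasTemperateGrowth

lemma hasTemperateGrowth_cexp :
    Function.HasTemperateGrowth (fun r : ℝ => Complex.exp (2 * Real.pi * Complex.I * r)) := by
  set c : ℂ := 2 * Real.pi * Complex.I with hc
  have hsm : ContDiff ℝ (⊤ : ℕ∞) (fun r : ℝ => Complex.exp (c * r)) :=
    (contDiff_const.mul Complex.ofRealCLM.contDiff).cexp
  have hit : ∀ n : ℕ, iteratedDeriv n (fun r : ℝ => Complex.exp (c * r)) =
      fun r : ℝ => c ^ n * Complex.exp (c * r) := by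
    intro n
    induction n with
    | zero => simp
    | succ n ih =>
      rw [iteratedDeriv_succ, ih]
      ext r
      have h1 : HasDerivAt (fun r : ℝ => c * (r : ℂ)) c r := by
        simpa using (Complex.ofRealCLM.hasDerivAt (x := r)).const_mul c
      have h2 := (h1.cexp).const_mul (c ^ n)
      rw [h2.deriv]
      ring
  refine ⟨hsm, fun n => ⟨0, ‖c‖ ^ n, fun r => ?_⟩⟩
  rw [norm_iteratedFDeriv_eq_norm_iteratedDeriv, hit]
  have : ‖Complex.exp (c * r)‖ = 1 := by
    rw [Complex.norm_exp]
    simp [hc]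
  simp [this]

/-- The unitary operator `ψ ↦ e^{2πi P} ψ(· - a)` on `𝓢(ℝ²)`, for a real phase `P` of
temperate growth. -/
def phaseShift (P : ℝ × ℝ → ℝ) (a : ℝ × ℝ) : 𝓢(ℝ × ℝ, ℂ) →L[ℂ] 𝓢(ℝ × ℝ, ℂ) :=
  SchwartzMap.smulLeftCLM ℂ (fun z => Complex.exp (2 * Real.pi * Complex.I * (P z : ℂ))) ∘L
    SchwartzMap.compSubConstCLM ℂ a

lemma phaseShift_apply {P : ℝ × ℝ → ℝ} (hP : P.HasTemperateGrowth) (a : ℝ × ℝ)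
    (ψ : 𝓢(ℝ × ℝ, ℂ)) (z : ℝ × ℝ) :
    phaseShift P a ψ z = Complex.exp (2 * Real.pi * Complex.I * (P z : ℂ)) * ψ (z - a) := by
  have h : Function.HasTemperateGrowth
      (fun z => Complex.exp (2 * Real.pi * Complex.I * (P z : ℂ))) :=
    hasTemperateGrowth_cexp.comp hP
  simp [phaseShift, SchwartzMap.smulLeftCLM_apply_apply h]

/-- Pointwise complex conjugation on `𝓢(ℝ²)`. -/
def conjS : 𝓢(ℝ × ℝ, ℂ) →SL[starRingEnd ℂ] 𝓢(ℝ × ℝ, ℂ) where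
  toFun ψ := SchwartzMap.postcompCLM (𝕜 := ℝ) (Complex.conjCLE : ℂ →L[ℝ] ℂ) ψ
  map_add' _ _ := map_add _ _ _
  map_smul' c ψ := by ext z; simp
  cont := (SchwartzMap.postcompCLM (𝕜 := ℝ) (Complex.conjCLE : ℂ →L[ℝ] ℂ)).cont

@[simp]
lemma conjS_apply (ψ : 𝓢(ℝ × ℝ, ℂ)) (z : ℝ × ℝ) : conjS ψ z = starRingEnd ℂ (ψ z) := rfl

/-- The pairing `⟨f, ψ⟩ = ∫ f ψ̄` of `f ∈ 𝓢'(ℝ²)` and `ψ ∈ 𝓢(ℝ²)`, conjugate-linear in `ψ`. -/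
def pair (f : 𝓢'(ℝ × ℝ, ℂ)) (ψ : 𝓢(ℝ × ℝ, ℂ)) : ℂ := f (conjS ψ)

/-! ### The representations -/

/-- The phase of `π_ν(x)` for `G_{5,3}`. -/
def phase53 (ν : ℝ) (x : G53) (z : ℝ × ℝ) : ℝ :=
  ν * (x.x1 - x.x3 * x.x4 + x.x4 * z.1 - x.x2 * z.2 + 1 / 2 * x.x4 * z.2 ^ 2)

lemma phase53_growth (ν : ℝ) (x : G53) : (phase53 ν x).HasTemperateGrowth := by
  have h1 := growth_fst
  have h2 := growth_snd
  unfold phase53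
  fun_prop

/-- The representation `π_ν` of `G_{5,3}` (on the space `𝓢(ℝ²)` of its smooth vectors):
`π_ν(x) g (s,t) = exp (2πiν (x₁ - x₃x₄ + x₄s - x₂t + x₄t²/2)) g(s - x₃, t - x₅)`. -/
def rep53 (ν : ℝ) : G53 →* (𝓢(ℝ × ℝ, ℂ) →L[ℂ] 𝓢(ℝ × ℝ, ℂ)) where
  toFun x := phaseShift (phase53 ν x) (x.x3, x.x5)
  map_one' := by
    ext ψ z
    rw [phaseShift_apply (phase53_growth ν 1)]
    have hz : z - (0, 0) = z := sub_zero z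
    simp [phase53, G53.one_def, hz]
  map_mul' x y := by
    ext ψ z
    rw [mul_apply_eq_comp, phaseShift_apply (phase53_growth ν _),
      phaseShift_apply (phase53_growth ν _), phaseShift_apply (phase53_growth ν _),
      ← mul_assoc, ← Complex.exp_add]
    congr 2
    · simp only [phase53, G53.mul_def, Prod.fst_sub, Prod.snd_sub]
      push_cast
      ring
    · simp only [G53.mul_def, Prod.ext_iff, Prod.fst_sub, Prod.snd_sub]
      constructor <;> ring

/-- The phase of `π_{lam,mu}(x)` for `G_{6,19}`. -/
def phase619 (lam mu : ℝ) (x : G619) (z : ℝ × ℝ) : ℝ :=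
  lam * (x.x1 - x.x3 * z.2) +
    mu * (x.x2 - 1 / 2 * x.x5 ^ 2 * x.x6 - x.x4 * z.1 + x.x5 * x.x6 * z.1
      - 1 / 2 * x.x6 * z.1 ^ 2)

lemma phase619_growth (lam mu : ℝ) (x : G619) : (phase619 lam mu x).HasTemperateGrowth := by
  have h1 := growth_fst
  have h2 := growth_snd
  unfold phase619
  fun_prop

/-- The representation `π_{lam,mu}` of `G_{6,19}` (on the space `𝓢(ℝ²)` of its smooth vectors):
`π_{lam,mu}(x) g (s,t)
  = exp (2πi (lam (x₁ - x₃t) + mu (x₂ - x₅²x₆/2 - x₄s + x₅x₆s - x₆s²/2))) g(s - x₅, t - x₆)`. -/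
def rep619 (lam mu : ℝ) : G619 →* (𝓢(ℝ × ℝ, ℂ) →L[ℂ] 𝓢(ℝ × ℝ, ℂ)) where
  toFun x := phaseShift (phase619 lam mu x) (x.x5, x.x6)
  map_one' := by
    ext ψ z
    rw [phaseShift_apply (phase619_growth lam mu 1)]
    have hz : z - (0, 0) = z := sub_zero z
    simp [phase619, G619.one_def, hz]
  map_mul' x y := by
    ext ψ z
    rw [mul_apply_eq_comp, phaseShift_apply (phase619_growth lam mu _),
      phaseShift_apply (phase619_growth lam mu _), phaseShift_apply (phase619_growth lam mu _),
      ← mul_assoc, ← Complex.exp_add]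
    congr 2
    · simp only [phase619, G619.mul_def, Prod.fst_sub, Prod.snd_sub]
      push_cast
      ring
    · simp only [G619.mul_def, Prod.ext_iff, Prod.fst_sub, Prod.snd_sub]
      constructor <;> ring

/-- The extension to `𝓢'(ℝ²)` of a unitary representation `ρ` acting on `𝓢(ℝ²)`, determined by
`⟨ρ(x) f, ψ⟩ = ⟨f, ρ(x⁻¹) ψ⟩`. -/
def distRep {G : Type*} [Group G] (ρ : G →* (𝓢(ℝ × ℝ, ℂ) →L[ℂ] 𝓢(ℝ × ℝ, ℂ))) (x : G)
    (f : 𝓢'(ℝ × ℝ, ℂ)) : 𝓢'(ℝ × ℝ, ℂ) :=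
  PointwiseConvergenceCLM.precomp ℂ
    ((conjS.comp ((ρ x⁻¹).comp conjS) : 𝓢(ℝ × ℝ, ℂ) →L[ℂ] 𝓢(ℝ × ℝ, ℂ))) f

lemma pair_distRep {G : Type*} [Group G] (ρ : G →* (𝓢(ℝ × ℝ, ℂ) →L[ℂ] 𝓢(ℝ × ℝ, ℂ))) (x : G)
    (f : 𝓢'(ℝ × ℝ, ℂ)) (ψ : 𝓢(ℝ × ℝ, ℂ)) :
    pair (distRep ρ x f) ψ = pair f (ρ x⁻¹ ψ) := by
  have h : conjS (conjS ψ) = ψ := by ext z; simp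
  change f (conjS (ρ x⁻¹ (conjS (conjS ψ)))) = f (conjS (ρ x⁻¹ ψ))
  rw [h]

/-- On Schwartz functions, `distRep` is the original representation. -/
lemma distRep_coe (ν : ℝ) (x : G53) (ψ : 𝓢(ℝ × ℝ, ℂ)) :
    distRep (rep53 ν) x (ψ : 𝓢'(ℝ × ℝ, ℂ)) = (rep53 ν x ψ : 𝓢'(ℝ × ℝ, ℂ)) := by
  ext χ
  change (ψ : 𝓢'(ℝ × ℝ, ℂ)) (conjS (rep53 ν x⁻¹ (conjS χ))) = _
  rw [SchwartzMap.coe_apply, SchwartzMap.coe_apply,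
    ← integral_sub_right_eq_self _ ((x.x3, x.x5) : ℝ × ℝ)]
  congr 1
  ext z
  have e1 : rep53 ν x ψ z = Complex.exp (2 * Real.pi * Complex.I * (phase53 ν x z : ℂ)) *
      ψ (z - (x.x3, x.x5)) := phaseShift_apply (phase53_growth ν x) _ ψ z
  have e2 : rep53 ν x⁻¹ (conjS χ) (z - (x.x3, x.x5)) =
      Complex.exp (2 * Real.pi * Complex.I * (phase53 ν x⁻¹ (z - (x.x3, x.x5)) : ℂ)) *
        conjS χ (z - (x.x3, x.x5) - (-x.x3, -x.x5)) :=
    phaseShift_apply (phase53_growth ν x⁻¹) _ _ _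
  have e3 : z - (x.x3, x.x5) - (-x.x3, -x.x5) = z := by ext <;> simp
  have e4 : phase53 ν x⁻¹ (z - (x.x3, x.x5)) = -phase53 ν x z := by
    simp only [phase53, G53.inv_def, Prod.fst_sub, Prod.snd_sub]
    ring
  rw [e1, conjS_apply, e2, e3, e4, conjS_apply, map_mul, Complex.conj_conj, ← Complex.exp_conj]
  simp [map_ofNat]
  ring_nf

/-! ### Coorbit spaces and modulation spaces -/

/-- The representation coefficient `V_g f (x) = ⟨f, ρ(x) g⟩`. -/
def coeff {G : Type*} [Group G] (ρ : G →* (𝓢(ℝ × ℝ, ℂ) →L[ℂ] 𝓢(ℝ × ℝ, ℂ)))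
    (g : 𝓢(ℝ × ℝ, ℂ)) (f : 𝓢'(ℝ × ℝ, ℂ)) (x : G) : ℂ :=
  pair f (ρ x g)

lemma pair_add (f f' : 𝓢'(ℝ × ℝ, ℂ)) (ψ : 𝓢(ℝ × ℝ, ℂ)) :
    pair (f + f') ψ = pair f ψ + pair f' ψ := rfl

lemma pair_smul (c : ℂ) (f : 𝓢'(ℝ × ℝ, ℂ)) (ψ : 𝓢(ℝ × ℝ, ℂ)) :
    pair (c • f) ψ = c • pair f ψ := rfl

lemma pair_zero (ψ : 𝓢(ℝ × ℝ, ℂ)) : pair 0 ψ = 0 := rfl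

/-- The coorbit space `Co_ρ L^p(G/Z)` with window `g`: the tempered distributions `f` such that
`V_g f ∈ L^p(G/Z)`. Here `σ : ℝ⁴ → G` is a section of `G/Z` which carries Lebesgue measure to
Haar measure. -/
def coorbit {G : Type*} [Group G] (ρ : G →* (𝓢(ℝ × ℝ, ℂ) →L[ℂ] 𝓢(ℝ × ℝ, ℂ)))
    (σ : ℝ × ℝ × ℝ × ℝ → G) (g : 𝓢(ℝ × ℝ, ℂ)) (p : ℝ≥0∞) :
    Submodule ℂ (𝓢'(ℝ × ℝ, ℂ)) where
  carrier := {f | MemLp (fun y => coeff ρ g f (σ y)) p volume}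
  zero_mem' := by simp [coeff, pair_zero]
  add_mem' h h' := by
    simp only [Set.mem_ofPred_eq, coeff, pair_add] at *
    exact h.add h'
  smul_mem' c f h := by
    simp only [Set.mem_ofPred_eq, coeff, pair_smul] at *
    exact h.const_smul c

/-- The norm `‖V_g f‖_{L^p(G/Z)}` of `Co_ρ L^p(G/Z)`. -/
def coorbitNorm {G : Type*} [Group G] (ρ : G →* (𝓢(ℝ × ℝ, ℂ) →L[ℂ] 𝓢(ℝ × ℝ, ℂ)))
    (σ : ℝ × ℝ × ℝ × ℝ → G) (g : 𝓢(ℝ × ℝ, ℂ)) (p : ℝ≥0∞) (f : 𝓢'(ℝ × ℝ, ℂ)) : ℝ :=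
  (eLpNorm (fun y => coeff ρ g f (σ y)) p volume).toReal

/-- The time-frequency shift `M_ξ T_x g (t) = e^{2πi ξ·t} g(t - x)` on `𝓢(ℝ²)`. -/
def timeFreqShift (x ξ : ℝ × ℝ) : 𝓢(ℝ × ℝ, ℂ) →L[ℂ] 𝓢(ℝ × ℝ, ℂ) :=
  phaseShift (fun z => ξ.1 * z.1 + ξ.2 * z.2) x

lemma timeFreqShift_apply (x ξ : ℝ × ℝ) (g : 𝓢(ℝ × ℝ, ℂ)) (z : ℝ × ℝ) :
    timeFreqShift x ξ g z =
      Complex.exp (2 * Real.pi * Complex.I * ((ξ.1 * z.1 + ξ.2 * z.2 : ℝ) : ℂ)) * g (z - x) := by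
  have h1 := growth_fst
  have h2 := growth_snd
  exact phaseShift_apply (by fun_prop) x g z

/-- The short-time Fourier transform `S_g f (x, ξ) = ⟨f, M_ξ T_x g⟩`. -/
def stft (g : 𝓢(ℝ × ℝ, ℂ)) (f : 𝓢'(ℝ × ℝ, ℂ)) (y : (ℝ × ℝ) × (ℝ × ℝ)) : ℂ :=
  pair f (timeFreqShift y.1 y.2 g)

/-- The modulation space `M^q(ℝ²)` with window `g`: the tempered distributions `f` such that
`S_g f ∈ L^q(ℝ⁴)`. -/
def modulationSpace (g : 𝓢(ℝ × ℝ, ℂ)) (q : ℝ≥0∞) : Submodule ℂ (𝓢'(ℝ × ℝ, ℂ)) where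
  carrier := {f | MemLp (stft g f) q volume}
  zero_mem' := by
    have : stft g 0 = 0 := rfl
    simp [this]
  add_mem' {f f'} h h' := by
    have : stft g (f + f') = stft g f + stft g f' := rfl
    simp only [Set.mem_ofPred_eq, this] at *
    exact h.add h'
  smul_mem' c f h := by
    have : stft g (c • f) = c • stft g f := rfl
    simp only [Set.mem_ofPred_eq, this] at *
    exact h.const_smul c

/-! ### The Gaussian -/

lemma pow_mul_exp_le (m : ℕ) (r : ℝ) (hr : 0 ≤ r) :
    (1 + r) ^ m * Real.exp (-Real.pi * r ^ 2) ≤ m.factorial * Real.exp 2 := by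
  have h1 : (1 + r) ^ m ≤ m.factorial * Real.exp (1 + r) := by
    have := Real.pow_div_factorial_le_exp (1 + r) (by positivity) m
    rwa [div_le_iff₀' (by positivity)] at this
  calc (1 + r) ^ m * Real.exp (-Real.pi * r ^ 2)
      ≤ m.factorial * Real.exp (1 + r) * Real.exp (-Real.pi * r ^ 2) := by gcongr
    _ = m.factorial * Real.exp (1 + r + -Real.pi * r ^ 2) := by
      rw [Real.exp_add (1 + r), mul_assoc]
    _ ≤ m.factorial * Real.exp 2 := by
      gcongr
      nlinarith [Real.pi_gt_three, sq_nonneg (2 * r - 1), sq_nonneg r]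

/-- The real Gaussian `e^{-π(s²+t²)}` as a Schwartz function. -/
def gaussianReal2 : 𝓢(ℝ × ℝ, ℝ) where
  toFun z := Real.exp (-Real.pi * (z.1 ^ 2 + z.2 ^ 2))
  smooth' := by fun_prop
  decay' k n := by
    have h1 := growth_fst
    have h2 := growth_snd
    have hQ : Function.HasTemperateGrowth
        (fun z : ℝ × ℝ => -Real.pi * (z.1 ^ 2 + z.2 ^ 2)) := by fun_prop
    obtain ⟨l, C, hC, h⟩ := hQ.norm_iteratedFDeriv_le_uniform n
    refine ⟨n.factorial * (1 + C) ^ n * ((k + l * n).factorial * Real.exp 2), fun z => ?_⟩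
    have hb := norm_iteratedFDeriv_comp_le (n := n) (N := ((⊤ : ℕ∞) : WithTop ℕ∞))
      (g := Real.exp) Real.contDiff_exp hQ.1 (mod_cast le_top) z
      (C := Real.exp (-Real.pi * (z.1 ^ 2 + z.2 ^ 2))) (D := (1 + C) * (1 + ‖z‖) ^ l)
      (fun i _ => by
        rw [norm_iteratedFDeriv_eq_norm_iteratedDeriv, iteratedDeriv_eq_iterate,
          Real.iter_deriv_exp]
        simp [Real.abs_exp])
      (fun i hi hi' => by
        calc _ ≤ C * (1 + ‖z‖) ^ l := h i hi' z
          _ ≤ (1 + C) * (1 + ‖z‖) ^ l := by gcongr; simp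
          _ ≤ _ := by
            apply le_self_pow₀ (one_le_mul_of_one_le_of_one_le (by simp [hC])
              (by simp [one_le_pow₀]))
            lia)
    have hz : ‖z‖ ^ 2 ≤ z.1 ^ 2 + z.2 ^ 2 := by
      rcases max_choice ‖z.1‖ ‖z.2‖ with hm | hm <;>
      · rw [Prod.norm_def, hm, Real.norm_eq_abs, sq_abs]
        nlinarith [sq_nonneg z.1, sq_nonneg z.2]
    have he : Real.exp (-Real.pi * (z.1 ^ 2 + z.2 ^ 2)) ≤ Real.exp (-Real.pi * ‖z‖ ^ 2) := by
      apply Real.exp_le_exp.2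
      nlinarith [Real.pi_pos]
    calc ‖z‖ ^ k * ‖iteratedFDeriv ℝ n
          (fun z : ℝ × ℝ => Real.exp (-Real.pi * (z.1 ^ 2 + z.2 ^ 2))) z‖
        ≤ (1 + ‖z‖) ^ k * (n.factorial * Real.exp (-Real.pi * ‖z‖ ^ 2) *
            ((1 + C) * (1 + ‖z‖) ^ l) ^ n) := by
          gcongr
          · simp
          · exact hb.trans (by gcongr)
      _ = n.factorial * (1 + C) ^ n *
            ((1 + ‖z‖) ^ (k + l * n) * Real.exp (-Real.pi * ‖z‖ ^ 2)) := by
          rw [mul_pow, ← pow_mul, pow_add]; ring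
      _ ≤ _ := by
          exact mul_le_mul_of_nonneg_left (pow_mul_exp_le _ _ (norm_nonneg z)) (by positivity)

/-- The Gaussian `(φ ⊗ φ)(s, t) = e^{-π(s²+t²)}`. -/
def gaussian2 : 𝓢(ℝ × ℝ, ℂ) :=
  SchwartzMap.postcompCLM (𝕜 := ℝ) Complex.ofRealCLM gaussianReal2

lemma gaussian2_apply (z : ℝ × ℝ) :
    gaussian2 z = ((Real.exp (-Real.pi * (z.1 ^ 2 + z.2 ^ 2)) : ℝ) : ℂ) := rfl

end Coorbit

end

/-! The spaces are separated by one family of test functions, the chirped Gaussians $e^{\pi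
i(as^2+bt^2)+2\pi ics}e^{-\pi(s^2+t^2)}$. In linear coordinates on the section, the coefficient of
$\pi_{\lambda,\mu}$ at a Schwartz function $\psi$ is the Fourier transform in $z$ of a Schwartz
kernel $K(z,x)$ built from $\psi(z)\overline{g(z-x)}$ (`coeff_rep619`). For a chirped Gaussian the
chirp factors out of $K$. Its own Fourier transform, after half of the Gaussian has been put into
it, has sup norm $\lesssim M^{-1/4}$ and $L^1$ norm $\lesssim M^{1/4}$, where $M=(1+a^2)(1+b^2)$.
Young's inequality passes both bounds to the coefficient, while its $L^2$ norm is independent of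
$a,b,c$ by Plancherel. Interpolation between $L^1$ and $L^\infty$ gives the upper bound
$M^{1/(2p)-1/4}$ for the $L^p$ norm, and Hölder against the conjugate exponent gives the matching
lower bound (`exists_eLpNorm_coeff_chirpGaussian_bounds`). The exponent vanishes only for $p=2$.

Both rival spaces contain a non-compact family of isometries producing such chirps. For $G_{5,3}$ it
is $\pi(0,0,0,u,0)$, which multiplies by $e^{2\pi iu(s+t^2/2)}$. For $M^q$ it is translation by $v$
in $t$: it is no chirp, but the coefficients of $\pi_{\lambda,\mu}$ at the translate are, up to a
phase and a measure-preserving change of variables, those of the Gaussian chirped by $\mu v$ in $s$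
(`coeff_rep619_translatedGaussian`). So along each family one norm is constant while the other is
comparable to a nontrivial power of $M\to\infty$.

Equality of two spaces as sets must still be turned into a comparison of norms. Completeness of the
coorbit spaces is bypassed: for a sequence $h_n$ bounded in the first norm and dominated by one
Schwartz seminorm, $c\mapsto\sum c_nh_n$ maps $\ell^1$ into the first space, hence by assumption
into the second, and the closed graph theorem on $\ell^1$ bounds the second norms of the $h_n$
(`exists_forall_eLpNorm_pair_le`). The windows of the two spaces never need to be related. -/

noncomputable section

namespace Coorbit

/-! ### The Fourier transform on `ℝ × ℝ` -/

/-- The character `z ↦ e^{-2πi w·z}` of `ℝ²`. -/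
def wave (w z : ℝ × ℝ) : ℂ :=
  Complex.exp (2 * Real.pi * Complex.I * ((-(w.1 * z.1 + w.2 * z.2) : ℝ) : ℂ))

lemma norm_cexp_two_pi (r : ℝ) : ‖Complex.exp (2 * Real.pi * Complex.I * (r : ℂ))‖ = 1 := by
  rw [Complex.norm_exp]; simp

lemma norm_wave (w z : ℝ × ℝ) : ‖wave w z‖ = 1 := norm_cexp_two_pi _

lemma enorm_wave (w z : ℝ × ℝ) : ‖wave w z‖ₑ = 1 := by
  rw [← ofReal_norm, norm_wave, ENNReal.ofReal_one]

@[fun_prop]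
lemma continuous_wave : Continuous fun y : (ℝ × ℝ) × (ℝ × ℝ) => wave y.1 y.2 := by
  unfold wave; fun_prop

lemma wave_sub_mul (w v z : ℝ × ℝ) : wave (w - v) z = wave w z * wave (-v) z := by
  simp only [wave, ← Complex.exp_add]
  congr 1
  simp only [Prod.fst_sub, Prod.snd_sub, Prod.fst_neg, Prod.snd_neg]
  push_cast
  ring

/-- The identity between the Euclidean plane and `ℝ × ℝ`. -/
def planeEquiv : WithLp 2 (ℝ × ℝ) ≃L[ℝ] ℝ × ℝ := WithLp.prodContinuousLinearEquiv 2 ℝ ℝ ℝ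

lemma measurePreserving_planeEquiv : MeasurePreserving planeEquiv volume volume :=
  WithLp.volume_preserving_ofLp ℝ ℝ

/-- The Fourier transform on `𝓢(ℝ²)`. -/
def planeFourier : 𝓢(ℝ × ℝ, ℂ) →L[ℂ] 𝓢(ℝ × ℝ, ℂ) :=
  compCLMOfContinuousLinearEquiv ℂ planeEquiv.symm ∘L
    fourierTransformCLM ℂ ∘L compCLMOfContinuousLinearEquiv ℂ planeEquiv

lemma planeFourier_apply (h : 𝓢(ℝ × ℝ, ℂ)) (w : ℝ × ℝ) :
    planeFourier h w = ∫ z, wave w z * h z := by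
  rw [← measurePreserving_planeEquiv.integral_comp
    planeEquiv.toHomeomorph.measurableEmbedding]
  change FourierTransform.fourier (fun v => h (planeEquiv v)) (planeEquiv.symm w) = _
  rw [Real.fourier_eq']
  refine integral_congr_ae (.of_forall fun v => ?_)
  simp only [smul_eq_mul, wave, WithLp.prod_inner_apply]
  congr 2
  change _ = 2 * (Real.pi : ℂ) * Complex.I * ((-(w.1 * v.ofLp.1 + w.2 * v.ofLp.2) : ℝ) : ℂ)
  have e1 : (planeEquiv.symm w).ofLp = w := rfl
  rw [e1]
  simp
  ring

lemma planeFourier_planeFourier (h : 𝓢(ℝ × ℝ, ℂ)) (z : ℝ × ℝ) :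
    planeFourier (planeFourier h) (-z) = h z := by
  have h1 : compCLMOfContinuousLinearEquiv ℂ planeEquiv (planeFourier h) =
      FourierTransform.fourier (compCLMOfContinuousLinearEquiv ℂ planeEquiv h) := by
    ext v; simp [planeFourier]
  have h2 := fourierInv_apply_eq
    (FourierTransform.fourier (compCLMOfContinuousLinearEquiv ℂ planeEquiv h))
  rw [FourierTransform.fourierInv_fourier_eq] at h2
  have h3 := congrArg (fun f => f (planeEquiv.symm z)) h2
  simp only [compCLMOfContinuousLinearEquiv_apply, Function.comp_apply,
    ContinuousLinearEquiv.apply_symm_apply] at h3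
  rw [h3, ← h1]
  simp [planeFourier]

lemma eq_integral_planeFourier (h : 𝓢(ℝ × ℝ, ℂ)) (z : ℝ × ℝ) :
    h z = ∫ v, wave (-v) z * planeFourier h v := by
  rw [← planeFourier_planeFourier h z, planeFourier_apply]
  refine integral_congr_ae (.of_forall fun v => ?_)
  simp only [wave, Prod.fst_neg, Prod.snd_neg]
  congr 4
  ring

lemma lintegral_sq_planeFourier (h : 𝓢(ℝ × ℝ, ℂ)) :
    ∫⁻ w, ‖planeFourier h w‖ₑ ^ 2 = ∫⁻ z, ‖h z‖ₑ ^ 2 := by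
  have key (k : 𝓢(WithLp 2 (ℝ × ℝ), ℂ)) :
      ∫⁻ v, ‖k v‖ₑ ^ 2 = ENNReal.ofReal (∫ v, ‖k v‖ ^ 2) := by
    rw [ofReal_integral_eq_lintegral_ofReal]
    · refine lintegral_congr fun v => ?_
      rw [ENNReal.ofReal_pow (norm_nonneg _), ofReal_norm]
    · exact (memLp_two_iff_integrable_sq_norm k.continuous.aestronglyMeasurable).1 (k.memLp 2)
    · exact .of_forall fun v => by positivity
  rw [← measurePreserving_planeEquiv.lintegral_comp_emb
      planeEquiv.toHomeomorph.measurableEmbedding,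
    ← measurePreserving_planeEquiv.lintegral_comp_emb
      planeEquiv.toHomeomorph.measurableEmbedding]
  have h1 := key (compCLMOfContinuousLinearEquiv ℂ planeEquiv h)
  have h2 := key (FourierTransform.fourier (compCLMOfContinuousLinearEquiv ℂ planeEquiv h))
  rw [integral_norm_sq_fourier, ← h1] at h2
  simpa [planeFourier] using h2

/-- The $L^1$ norm is bounded by a Schwartz seminorm, and composing that seminorm with `T` leaves it
continuous, hence dominated by finitely many of the defining ones. Needed for the decay of
`fibreNorm` and for the domination of the chirps in $\mathcal S'$. -/
lemma exists_lintegral_enorm_clm_le (T : 𝓢(ℝ × ℝ, ℂ) →L[ℂ] 𝓢(ℝ × ℝ, ℂ)) :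
    ∃ (s : Finset (ℕ × ℕ)) (C : NNReal), ∀ h : 𝓢(ℝ × ℝ, ℂ), ∫⁻ w, ‖T h w‖ₑ ≤
      C * ENNReal.ofReal (s.sup (schwartzSeminormFamily ℂ (ℝ × ℝ) ℂ) h) := by
  obtain ⟨k, C, hC⟩ := eLpNorm_le_seminorm ℂ (E := ℝ × ℝ) ℂ 1
  set q : Seminorm ℂ 𝓢(ℝ × ℝ, ℂ) :=
    ((Finset.Iic (k, 0)).sup (schwartzSeminormFamily ℂ (ℝ × ℝ) ℂ)).comp
      (T : 𝓢(ℝ × ℝ, ℂ) →ₗ[ℂ] 𝓢(ℝ × ℝ, ℂ)) with hq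
  have hqc : Continuous q := by
    have : Continuous ((Finset.Iic (k, 0)).sup (schwartzSeminormFamily ℂ (ℝ × ℝ) ℂ) :
        Seminorm ℂ 𝓢(ℝ × ℝ, ℂ)) :=
      Seminorm.continuous_finsetSup fun i _ =>
        (schwartz_withSeminorms ℂ (ℝ × ℝ) ℂ).continuous_seminorm i
    exact this.comp T.continuous
  obtain ⟨s, D, -, hD⟩ := Seminorm.bound_of_continuous (schwartz_withSeminorms ℂ (ℝ × ℝ) ℂ) q hqc
  refine ⟨s, C * D, fun h => ?_⟩
  rw [← eLpNorm_one_eq_lintegral_enorm]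
  refine (hC _).trans ?_
  have h1 : ENNReal.ofReal (q h) ≤
      ENNReal.ofReal (D * s.sup (schwartzSeminormFamily ℂ (ℝ × ℝ) ℂ) h) :=
    ENNReal.ofReal_le_ofReal (hD h)
  rw [ENNReal.ofReal_mul (p := (D : ℝ)) D.coe_nonneg, ENNReal.ofReal_coe_nnreal] at h1
  rw [ENNReal.coe_mul, mul_assoc]
  gcongr
  exact h1

/-! ### Tensor products and fibres of Schwartz functions -/

lemma norm_pow_le_add {E F : Type*} [NormedAddCommGroup E] [NormedAddCommGroup F] (x : E × F)
    (k : ℕ) : ‖x‖ ^ k ≤ ‖x.1‖ ^ k + ‖x.2‖ ^ k := by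
  rcases max_choice ‖x.1‖ ‖x.2‖ with h | h <;> rw [Prod.norm_def, h]
  · exact le_add_of_nonneg_right (by positivity)
  · exact le_add_of_nonneg_left (by positivity)

section Fibre

variable {E F : Type*} [NormedAddCommGroup E] [NormedSpace ℝ E]
  [NormedAddCommGroup F] [NormedSpace ℝ F]

lemma norm_iteratedFDeriv_comp_le_of_norm_le_one {f : F → ℂ} (hf : ContDiff ℝ (⊤ : ℕ∞) f)
    (L : E →L[ℝ] F) (hL : ‖L‖ ≤ 1) (n : ℕ) (x : E) :
    ‖iteratedFDeriv ℝ n (fun y => f (L y)) x‖ ≤ ‖iteratedFDeriv ℝ n f (L x)‖ := by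
  have h := L.iteratedFDeriv_comp_right hf x (i := n) (mod_cast le_top)
  rw [show (fun y => f (L y)) = f ∘ L from rfl, h]
  refine (ContinuousMultilinearMap.norm_compContinuousLinearMap_le _ _).trans ?_
  refine mul_le_of_le_one_right (norm_nonneg _) ?_
  exact Finset.prod_le_one (fun _ _ => norm_nonneg _) fun _ _ => hL

/-- The tensor product `(f ⊗ g)(z, y) = f z * g y` of Schwartz functions. -/
def tensor (f : 𝓢(E, ℂ)) (g : 𝓢(F, ℂ)) : 𝓢(E × F, ℂ) where
  toFun x := f x.1 * g x.2
  smooth' := ((f.smooth ⊤).comp contDiff_fst).mul ((g.smooth ⊤).comp contDiff_snd)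
  decay' k n := by
    -- Leibniz rule, with the weight $\|x\|^k\le\|x_1\|^k+\|x_2\|^k$ given to one factor at a time.
    refine ⟨∑ i ∈ Finset.range (n + 1), (n.choose i : ℝ) *
      (SchwartzMap.seminorm ℝ k i f * SchwartzMap.seminorm ℝ 0 (n - i) g +
        SchwartzMap.seminorm ℝ 0 i f * SchwartzMap.seminorm ℝ k (n - i) g), fun x => ?_⟩
    have h1 : ContDiff ℝ (⊤ : ℕ∞) fun x : E × F => f x.1 := (f.smooth ⊤).comp contDiff_fst
    have h2 : ContDiff ℝ (⊤ : ℕ∞) fun x : E × F => g x.2 := (g.smooth ⊤).comp contDiff_snd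
    have h := norm_iteratedFDeriv_mul_le h1 h2 x (n := n) (mod_cast le_top)
    refine (mul_le_mul_of_nonneg_left h (by positivity)).trans ?_
    rw [Finset.mul_sum]
    refine Finset.sum_le_sum fun i _ => ?_
    have e1 := norm_iteratedFDeriv_comp_le_of_norm_le_one (f.smooth ⊤)
      (ContinuousLinearMap.fst ℝ E F) (ContinuousLinearMap.norm_fst_le ℝ E F) i x
    have e2 := norm_iteratedFDeriv_comp_le_of_norm_le_one (g.smooth ⊤)
      (ContinuousLinearMap.snd ℝ E F) (ContinuousLinearMap.norm_snd_le ℝ E F) (n - i) x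
    simp only [ContinuousLinearMap.coe_fst', ContinuousLinearMap.coe_snd'] at e1 e2
    have a1 := f.le_seminorm ℝ k i x.1
    have a2 := f.le_seminorm ℝ 0 i x.1
    have b1 := g.le_seminorm ℝ k (n - i) x.2
    have b2 := g.le_seminorm ℝ 0 (n - i) x.2
    simp only [pow_zero, one_mul] at a2 b2
    calc ‖x‖ ^ k * (n.choose i * ‖iteratedFDeriv ℝ i (fun x : E × F => f x.1) x‖ *
          ‖iteratedFDeriv ℝ (n - i) (fun x : E × F => g x.2) x‖)
        ≤ (‖x.1‖ ^ k + ‖x.2‖ ^ k) * (n.choose i * ‖iteratedFDeriv ℝ i f x.1‖ *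
          ‖iteratedFDeriv ℝ (n - i) g x.2‖) := by
          gcongr
          exact norm_pow_le_add x k
      _ = n.choose i * ((‖x.1‖ ^ k * ‖iteratedFDeriv ℝ i f x.1‖) *
            ‖iteratedFDeriv ℝ (n - i) g x.2‖ +
          ‖iteratedFDeriv ℝ i f x.1‖ * (‖x.2‖ ^ k * ‖iteratedFDeriv ℝ (n - i) g x.2‖)) := by ring
      _ ≤ _ := by gcongr

lemma hasTemperateGrowth_prodMk_right (x : F) :
    Function.HasTemperateGrowth fun z : E => (z, x) := by
  have h : (fun z : E => (z, x)) = fun z => ContinuousLinearMap.inl ℝ E F z + (0, x) := by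
    ext z <;> simp
  rw [h]
  exact (ContinuousLinearMap.inl ℝ E F).hasTemperateGrowth.add (.const _)

/-- The fibre `z ↦ K (z, x)` of a Schwartz function `K`. -/
def fibre (K : 𝓢(E × F, ℂ)) (x : F) : 𝓢(E, ℂ) :=
  compCLM ℂ (hasTemperateGrowth_prodMk_right x)
    ⟨1, 1, fun z => by
      have := norm_fst_le (z, x)
      simp only [pow_one, one_mul]
      linarith⟩ K

lemma norm_iteratedFDeriv_fibre_le (K : 𝓢(E × F, ℂ)) (x : F) (n : ℕ) (z : E) :
    ‖iteratedFDeriv ℝ n (fibre K x) z‖ ≤ ‖iteratedFDeriv ℝ n K (z, x)‖ := by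
  have hc : ContDiff ℝ (⊤ : ℕ∞) fun y : E × F => K (y + (0, x)) :=
    (K.smooth ⊤).comp (contDiff_id.add contDiff_const)
  have h := norm_iteratedFDeriv_comp_le_of_norm_le_one hc (ContinuousLinearMap.inl ℝ E F)
    (ContinuousLinearMap.norm_inl_le_one ℝ E F) n z
  rw [iteratedFDeriv_comp_add_right] at h
  simpa [fibre] using! h

/-- Both $\|x\|$ and $\|z\|$ are at most $\|(z,x)\|$, so the joint decay of `K` pays for a power of
$\|x\|$ in front of each seminorm of the fibre. -/
lemma pow_mul_seminorm_fibre_le (K : 𝓢(E × F, ℂ)) (x : F) (m k n : ℕ) :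
    ‖x‖ ^ m * SchwartzMap.seminorm ℂ k n (fibre K x) ≤ SchwartzMap.seminorm ℂ (k + m) n K := by
  have key (z : E) : ‖x‖ ^ m * (‖z‖ ^ k * ‖iteratedFDeriv ℝ n (fibre K x) z‖) ≤
      SchwartzMap.seminorm ℂ (k + m) n K := by
    refine le_trans ?_ (K.le_seminorm ℂ (k + m) n (z, x))
    calc ‖x‖ ^ m * (‖z‖ ^ k * ‖iteratedFDeriv ℝ n (fibre K x) z‖)
        ≤ ‖(z, x)‖ ^ m * (‖(z, x)‖ ^ k * ‖iteratedFDeriv ℝ n K (z, x)‖) := by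
          gcongr
          · exact norm_snd_le (z, x)
          · exact norm_fst_le (z, x)
          · exact norm_iteratedFDeriv_fibre_le K x n z
      _ = _ := by ring
  rcases eq_or_lt_of_le (pow_nonneg (norm_nonneg x) m) with h0 | h0
  · rw [← h0, zero_mul]; exact apply_nonneg _ _
  · rw [← le_div_iff₀' h0]
    refine (fibre K x).seminorm_le_bound ℂ k n (by positivity) fun z => ?_
    rw [le_div_iff₀' h0]
    exact key z

lemma exists_pow_mul_sup_seminorm_fibre_le (K : 𝓢(E × F, ℂ)) (s : Finset (ℕ × ℕ)) (m : ℕ) :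
    ∃ D : ℝ, 0 ≤ D ∧ ∀ x : F,
      (1 + ‖x‖) ^ m * s.sup (schwartzSeminormFamily ℂ E ℂ) (fibre K x) ≤ D := by
  refine ⟨∑ i ∈ s, 2 ^ (m - 1) * (SchwartzMap.seminorm ℂ i.1 i.2 K +
    SchwartzMap.seminorm ℂ (i.1 + m) i.2 K), by positivity, fun x => ?_⟩
  -- Convexity of the power; for `m = 0` the truncated exponent is $0$ and the bound reads $1\le2$.
  have hx : (1 + ‖x‖) ^ m ≤ 2 ^ (m - 1) * (1 + ‖x‖ ^ m) := by
    simpa using add_pow_le zero_le_one (norm_nonneg x) m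
  have h1 : s.sup (schwartzSeminormFamily ℂ E ℂ) (fibre K x) ≤
      ∑ i ∈ s, SchwartzMap.seminorm ℂ i.1 i.2 (fibre K x) := by
    refine Seminorm.finset_sup_apply_le (Finset.sum_nonneg fun _ _ => apply_nonneg _ _)
      fun i hi => ?_
    exact Finset.single_le_sum (f := fun i : ℕ × ℕ => SchwartzMap.seminorm ℂ i.1 i.2 (fibre K x))
      (fun _ _ => apply_nonneg _ _) hi
  refine (mul_le_mul hx h1 (apply_nonneg _ _) (by positivity)).trans ?_
  rw [Finset.mul_sum]
  refine Finset.sum_le_sum fun i _ => ?_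
  have h2 := pow_mul_seminorm_fibre_le K x 0 i.1 i.2
  have h3 := pow_mul_seminorm_fibre_le K x m i.1 i.2
  simp only [pow_zero, one_mul, add_zero] at h2
  rw [mul_assoc, add_mul, one_mul]
  gcongr

end Fibre

/-! ### The partial Fourier transform -/

/-- The Fourier transform of `K` in the first variable. -/
def partialFourier (K : (ℝ × ℝ) × (ℝ × ℝ) → ℂ) (y : (ℝ × ℝ) × (ℝ × ℝ)) : ℂ :=
  ∫ z, wave y.1 z * K (z, y.2)

lemma partialFourier_eq (K : 𝓢((ℝ × ℝ) × (ℝ × ℝ), ℂ)) (y : (ℝ × ℝ) × (ℝ × ℝ)) :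
    partialFourier K y = planeFourier (fibre K y.2) y.1 := by
  rw [planeFourier_apply]; rfl

lemma stronglyMeasurable_partialFourier {K : (ℝ × ℝ) × (ℝ × ℝ) → ℂ} (hK : Continuous K) :
    StronglyMeasurable (partialFourier K) := by
  have : Continuous fun q : ((ℝ × ℝ) × (ℝ × ℝ)) × (ℝ × ℝ) => wave q.1.1 q.2 * K (q.2, q.1.2) := by
    have h1 : Continuous fun q : ((ℝ × ℝ) × (ℝ × ℝ)) × (ℝ × ℝ) => wave q.1.1 q.2 :=
      continuous_wave.comp (f := fun q : ((ℝ × ℝ) × (ℝ × ℝ)) × (ℝ × ℝ) => (q.1.1, q.2))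
        (by fun_prop)
    exact h1.mul (hK.comp (by fun_prop))
  exact this.stronglyMeasurable.integral_prod_right

/-- Plancherel on each fibre, then Tonelli. -/
lemma lintegral_sq_partialFourier (K : 𝓢((ℝ × ℝ) × (ℝ × ℝ), ℂ)) :
    ∫⁻ y, ‖partialFourier K y‖ₑ ^ 2 = ∫⁻ y, ‖K y‖ₑ ^ 2 := by
  have h1 := (stronglyMeasurable_partialFourier K.continuous).measurable.enorm.pow_const 2
  have h2 := K.continuous.measurable.enorm.pow_const 2
  rw [Measure.volume_eq_prod, lintegral_prod_symm' _ h1, lintegral_prod_symm' _ h2]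
  refine lintegral_congr fun x => ?_
  simp only [partialFourier_eq]
  exact lintegral_sq_planeFourier (fibre K x)

/-- The `L¹` norm of the Fourier transform of a fibre. -/
def fibreNorm (K : 𝓢((ℝ × ℝ) × (ℝ × ℝ), ℂ)) (x : ℝ × ℝ) : ℝ≥0∞ :=
  ∫⁻ w, ‖planeFourier (fibre K x) w‖ₑ

lemma measurable_fibreNorm (K : 𝓢((ℝ × ℝ) × (ℝ × ℝ), ℂ)) : Measurable (fibreNorm K) := by
  have h := (stronglyMeasurable_partialFourier K.continuous).measurable.enorm.lintegral_prod_left'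
    (μ := (volume : Measure (ℝ × ℝ)))
  simpa only [partialFourier_eq] using! h

lemma exists_fibreNorm_le (K : 𝓢((ℝ × ℝ) × (ℝ × ℝ), ℂ)) : ∃ D : ℝ, 0 ≤ D ∧ ∀ x,
    fibreNorm K x ≤ ENNReal.ofReal (D * (1 + ‖x‖) ^ (-3 : ℝ)) := by
  obtain ⟨s, C, hC⟩ := exists_lintegral_enorm_clm_le planeFourier
  -- The power 3 exceeds the dimension 2 of the variable `x`, so the resulting bound is integrable.
  obtain ⟨D, hD0, hD⟩ := exists_pow_mul_sup_seminorm_fibre_le K s 3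
  refine ⟨C * D, by positivity, fun x => (hC _).trans ?_⟩
  have hx : 0 < (1 + ‖x‖) ^ 3 := by positivity
  rw [mul_assoc, ENNReal.ofReal_mul C.coe_nonneg, ENNReal.ofReal_coe_nnreal]
  gcongr
  rw [Real.rpow_neg (by positivity), ← div_eq_mul_inv, le_div_iff₀ (by positivity), mul_comm]
  exact_mod_cast hD x

lemma exists_forall_fibreNorm_le (K : 𝓢((ℝ × ℝ) × (ℝ × ℝ), ℂ)) :
    ∃ D : ℝ, 0 ≤ D ∧ ∀ x, fibreNorm K x ≤ ENNReal.ofReal D := by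
  obtain ⟨D, hD0, hD⟩ := exists_fibreNorm_le K
  refine ⟨D, hD0, fun x => (hD x).trans (ENNReal.ofReal_le_ofReal ?_)⟩
  refine mul_le_of_le_one_right hD0 ?_
  exact Real.rpow_le_one_of_one_le_of_nonpos (by simp) (by norm_num)

lemma lintegral_fibreNorm_lt_top (K : 𝓢((ℝ × ℝ) × (ℝ × ℝ), ℂ)) :
    ∫⁻ x, fibreNorm K x < ∞ := by
  obtain ⟨D, hD0, hD⟩ := exists_fibreNorm_le K
  refine (lintegral_mono hD).trans_lt ?_
  have h : Integrable (fun x : ℝ × ℝ => D * (1 + ‖x‖) ^ (-3 : ℝ)) :=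
    (integrable_one_add_norm (by simp; norm_num)).const_mul D
  refine lt_of_le_of_lt (lintegral_mono fun x => ?_) h.2
  rw [← ofReal_norm]
  exact ENNReal.ofReal_le_ofReal (le_abs_self _)

/-! ### Multiplication by a function with integrable Fourier transform -/

/-- The Fourier transform of a product is the convolution of the transforms: insert the inversion
formula for `h` and apply Fubini, justified because $G\otimes\hat h$ is integrable. No integrability
of $\hat G$ is required. -/
lemma integral_wave_mul_mul {G : ℝ × ℝ → ℂ} (hG : Integrable G) (h : 𝓢(ℝ × ℝ, ℂ)) (w : ℝ × ℝ) :
    ∫ z, wave w z * (G z * h z) =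
      ∫ v, planeFourier h v * ∫ z, wave (w - v) z * G z := by
  have hint : Integrable (fun q : (ℝ × ℝ) × (ℝ × ℝ) =>
      wave (w - q.2) q.1 * (G q.1 * planeFourier h q.2)) (volume.prod volume) := by
    refine (hG.mul_prod (planeFourier h).integrable).bdd_mul (c := 1) ?_ ?_
    · refine Continuous.aestronglyMeasurable ?_
      exact continuous_wave.comp (f := fun q : (ℝ × ℝ) × (ℝ × ℝ) => (w - q.2, q.1))
        (by fun_prop)
    · exact .of_forall fun q => (norm_wave _ _).le
  calc ∫ z, wave w z * (G z * h z)
      = ∫ z, ∫ v, wave (w - v) z * (G z * planeFourier h v) := by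
        refine integral_congr_ae (.of_forall fun z => ?_)
        simp only
        rw [eq_integral_planeFourier h z, ← mul_assoc, ← integral_const_mul]
        refine integral_congr_ae (.of_forall fun v => ?_)
        simp only [wave_sub_mul w v z]
        ring
    _ = ∫ v, ∫ z, wave (w - v) z * (G z * planeFourier h v) := integral_integral_swap hint
    _ = _ := by
        refine integral_congr_ae (.of_forall fun v => ?_)
        simp only
        rw [← integral_const_mul]
        refine integral_congr_ae (.of_forall fun z => ?_)
        simp only
        ring

lemma measurable_integral_wave_mul {G : ℝ × ℝ → ℂ} (hG : Continuous G) :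
    Measurable fun w => ∫ z, wave w z * G z := by
  have h : Continuous fun q : (ℝ × ℝ) × (ℝ × ℝ) => wave q.1 q.2 * G q.2 :=
    continuous_wave.mul (hG.comp continuous_snd)
  exact h.stronglyMeasurable.integral_prod_right.measurable

/-- Young's inequality $\|\hat G*\hat h\|_\infty\le\|\hat G\|_\infty\|\hat h\|_1$. -/
lemma enorm_integral_wave_mul_mul_le {G : ℝ × ℝ → ℂ} (hG : Integrable G) {S : ℝ≥0∞}
    (hS : ∀ w, ‖∫ z, wave w z * G z‖ₑ ≤ S) (h : 𝓢(ℝ × ℝ, ℂ)) (w : ℝ × ℝ) :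
    ‖∫ z, wave w z * (G z * h z)‖ₑ ≤ S * ∫⁻ v, ‖planeFourier h v‖ₑ := by
  rw [integral_wave_mul_mul hG]
  refine (enorm_integral_le_lintegral_enorm _).trans ?_
  rw [← lintegral_const_mul _ (planeFourier h).continuous.measurable.enorm]
  refine lintegral_mono fun v => ?_
  rw [enorm_mul, mul_comm]
  gcongr
  exact hS _

/-- Young's inequality $\|\hat G*\hat h\|_1\le\|\hat G\|_1\|\hat h\|_1$, by Tonelli and translation
invariance. -/
lemma lintegral_enorm_integral_wave_mul_mul_le {G : ℝ × ℝ → ℂ} (hG : Integrable G)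
    (hGc : Continuous G) (h : 𝓢(ℝ × ℝ, ℂ)) :
    ∫⁻ w, ‖∫ z, wave w z * (G z * h z)‖ₑ ≤
      (∫⁻ w, ‖∫ z, wave w z * G z‖ₑ) * ∫⁻ v, ‖planeFourier h v‖ₑ := by
  set Γ : ℝ × ℝ → ℂ := fun w => ∫ z, wave w z * G z with hΓ
  have hΓm : Measurable Γ := measurable_integral_wave_mul hGc
  have hhm : Measurable (planeFourier h) := (planeFourier h).continuous.measurable
  calc ∫⁻ w, ‖∫ z, wave w z * (G z * h z)‖ₑ
      ≤ ∫⁻ w, ∫⁻ v, ‖planeFourier h v‖ₑ * ‖Γ (w - v)‖ₑ := by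
        refine lintegral_mono fun w => ?_
        rw [integral_wave_mul_mul hG]
        refine (enorm_integral_le_lintegral_enorm _).trans (le_of_eq ?_)
        simp only [enorm_mul, hΓ]
    _ = ∫⁻ v, ∫⁻ w, ‖planeFourier h v‖ₑ * ‖Γ (w - v)‖ₑ := by
        refine lintegral_lintegral_swap (Measurable.aemeasurable ?_)
        exact (hhm.comp measurable_snd).enorm.mul
          (hΓm.comp (measurable_fst.sub measurable_snd)).enorm
    _ = ∫⁻ v, (∫⁻ w, ‖Γ w‖ₑ) * ‖planeFourier h v‖ₑ := by
        refine lintegral_congr fun v => ?_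
        have hm : Measurable fun w => ‖Γ (w - v)‖ₑ := (hΓm.comp (measurable_sub_const v)).enorm
        rw [lintegral_const_mul _ hm, lintegral_sub_right_eq_self (fun w => ‖Γ w‖ₑ) v, mul_comm]
    _ = _ := lintegral_const_mul _ hhm.enorm

lemma enorm_partialFourier_mul_le {G : ℝ × ℝ → ℂ} (hG : Integrable G) {S : ℝ≥0∞}
    (hS : ∀ w, ‖∫ z, wave w z * G z‖ₑ ≤ S) (K : 𝓢((ℝ × ℝ) × (ℝ × ℝ), ℂ))
    (y : (ℝ × ℝ) × (ℝ × ℝ)) :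
    ‖partialFourier (fun q => G q.1 * K q) y‖ₑ ≤ S * fibreNorm K y.2 :=
  enorm_integral_wave_mul_mul_le hG hS (fibre K y.2) y.1

lemma lintegral_enorm_partialFourier_mul_le {G : ℝ × ℝ → ℂ} (hG : Integrable G)
    (hGc : Continuous G) (K : 𝓢((ℝ × ℝ) × (ℝ × ℝ), ℂ)) :
    ∫⁻ y, ‖partialFourier (fun q => G q.1 * K q) y‖ₑ ≤
      (∫⁻ w, ‖∫ z, wave w z * G z‖ₑ) * ∫⁻ x, fibreNorm K x := by
  have hm := (stronglyMeasurable_partialFourier (K := fun q => G q.1 * K q)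
    ((hGc.comp continuous_fst).mul K.continuous)).measurable.enorm
  rw [Measure.volume_eq_prod, lintegral_prod_symm' _ hm]
  refine (lintegral_mono fun x =>
    lintegral_enorm_integral_wave_mul_mul_le hG hGc (fibre K x)).trans ?_
  exact (lintegral_const_mul _ (measurable_fibreNorm K)).le

lemma lintegral_enorm_partialFourier_lt_top (K : 𝓢((ℝ × ℝ) × (ℝ × ℝ), ℂ)) :
    ∫⁻ y, ‖partialFourier K y‖ₑ < ∞ := by
  have hm := (stronglyMeasurable_partialFourier K.continuous).measurable.enorm
  rw [Measure.volume_eq_prod, lintegral_prod_symm' _ hm]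
  simp only [partialFourier_eq]
  exact lintegral_fibreNorm_lt_top K

lemma exists_enorm_partialFourier_le (K : 𝓢((ℝ × ℝ) × (ℝ × ℝ), ℂ)) :
    ∃ D : ℝ, ∀ y, ‖partialFourier K y‖ₑ ≤ ENNReal.ofReal D := by
  obtain ⟨k, C, hC⟩ := eLpNorm_le_seminorm ℂ (E := ℝ × ℝ) ℂ 1
  obtain ⟨D, -, hD⟩ := exists_pow_mul_sup_seminorm_fibre_le K (Finset.Iic (k, 0)) 0
  refine ⟨C * D, fun y => (enorm_integral_le_lintegral_enorm _).trans ?_⟩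
  have h := hC (fibre K y.2)
  rw [eLpNorm_one_eq_lintegral_enorm] at h
  simp only [enorm_mul, enorm_wave, one_mul]
  refine h.trans ?_
  rw [ENNReal.ofReal_mul C.coe_nonneg, ENNReal.ofReal_coe_nnreal]
  gcongr
  simpa using hD y.2

/-! ### Chirped Gaussians -/

/-- The chirped Gaussian `e^{-πs²/2} e^{πias² + 2πics}` on the line. -/
def lineChirp (a c s : ℝ) : ℂ :=
  Complex.exp (-Real.pi * (1 / 2 - a * Complex.I) * (s : ℂ) ^ 2 +
    2 * Real.pi * (Complex.I * c) * s)

lemma continuous_lineChirp (a c : ℝ) : Continuous (lineChirp a c) := by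
  unfold lineChirp; fun_prop

lemma re_half_sub (a : ℝ) : 0 < (1 / 2 - a * Complex.I : ℂ).re := by
  norm_num

lemma integrable_lineChirp (a c : ℝ) : Integrable (lineChirp a c) := by
  have h := integrable_cexp_quadratic' (b := -Real.pi * (1 / 2 - a * Complex.I)) (by
    simpa using Real.pi_pos) (2 * Real.pi * (Complex.I * c)) 0
  simpa only [add_zero] using! h

/-- The integrand is a Gaussian with complex parameter $\beta=\frac12-ia$, whose transform has
modulus $|\beta|^{-1/2}e^{-\pi\,\mathrm{Re}(1/\beta)(w-c)^2}$; here $|\beta|^2=\frac14+a^2$ and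
$\mathrm{Re}(1/\beta)=\frac12/|\beta|^2$. A strong chirp thus flattens and spreads the transform,
and `c` only translates it. -/
lemma norm_integral_lineChirp (a c w : ℝ) :
    ‖∫ s, Complex.exp (2 * Real.pi * Complex.I * ((-(w * s) : ℝ) : ℂ)) * lineChirp a c s‖ =
      (1 / 4 + a ^ 2) ^ (-(1 / 4) : ℝ) *
        Real.exp (-(Real.pi / 2 / (1 / 4 + a ^ 2)) * (w - c) ^ 2) := by
  have h := congrFun (fourier_gaussian_pi' (re_half_sub a) (Complex.I * c)) w
  have h0 : 0 < 1 / 4 + a ^ 2 := by positivity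
  have hn : Complex.normSq (1 / 2 - a * Complex.I) = 1 / 4 + a ^ 2 := by
    rw [Complex.normSq_apply]; simp; ring
  have hb : (1 / 2 - a * Complex.I : ℂ) ≠ 0 := by
    intro hz; rw [hz, map_zero] at hn; linarith
  rw [Real.fourier_eq'] at h
  have e : ∫ s, Complex.exp (2 * Real.pi * Complex.I * ((-(w * s) : ℝ) : ℂ)) * lineChirp a c s =
      1 / (1 / 2 - a * Complex.I : ℂ) ^ (1 / 2 : ℂ) *
        Complex.exp (-Real.pi / (1 / 2 - a * Complex.I) * (w + Complex.I * (Complex.I * c)) ^ 2) := by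
    rw [← h]
    refine integral_congr_ae (.of_forall fun s => ?_)
    simp only [smul_eq_mul, lineChirp]
    congr 2
    simp
    ring
  rw [e, norm_mul, Complex.norm_exp]
  congr 1
  · have e3 : ‖(1 / 2 - a * Complex.I : ℂ)‖ = (1 / 4 + a ^ 2) ^ (1 / 2 : ℝ) := by
      rw [← Real.sqrt_eq_rpow, ← hn]; rfl
    have e4 : ‖(1 / 2 - a * Complex.I : ℂ) ^ (1 / 2 : ℂ)‖ = (1 / 4 + a ^ 2) ^ (1 / 4 : ℝ) := by
      have := Complex.norm_cpow_real (1 / 2 - a * Complex.I) (1 / 2)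
      rw [e3, ← Real.rpow_mul h0.le] at this
      norm_num at this ⊢
      exact this
    rw [norm_div, norm_one, e4, Real.rpow_neg h0.le, one_div]
  · congr 1
    have e2 : (w : ℂ) + Complex.I * (Complex.I * c) = ((w - c : ℝ) : ℂ) := by
      rw [← mul_assoc, Complex.I_mul_I]; push_cast; ring
    rw [e2, ← Complex.ofReal_pow, Complex.re_mul_ofReal]
    congr 1
    rw [← Complex.ofReal_neg, div_eq_mul_inv, Complex.re_ofReal_mul, Complex.inv_re, hn]
    simp
    ring

/-- The function `e^{-π(s²+t²)/2} e^{πi(as²+bt²) + 2πics}` on the plane. -/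
def planeChirp (a b c : ℝ) (z : ℝ × ℝ) : ℂ := lineChirp a c z.1 * lineChirp b 0 z.2

lemma continuous_planeChirp (a b c : ℝ) : Continuous (planeChirp a b c) :=
  ((continuous_lineChirp a c).comp continuous_fst).mul
    ((continuous_lineChirp b 0).comp continuous_snd)

lemma integrable_planeChirp (a b c : ℝ) : Integrable (planeChirp a b c) :=
  (integrable_lineChirp a c).mul_prod (integrable_lineChirp b 0)

lemma norm_integral_planeChirp (a b c : ℝ) (w : ℝ × ℝ) :
    ‖∫ z, wave w z * planeChirp a b c z‖ =
      ((1 / 4 + a ^ 2) ^ (-(1 / 4) : ℝ) *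
        Real.exp (-(Real.pi / 2 / (1 / 4 + a ^ 2)) * (w.1 - c) ^ 2)) *
      ((1 / 4 + b ^ 2) ^ (-(1 / 4) : ℝ) *
        Real.exp (-(Real.pi / 2 / (1 / 4 + b ^ 2)) * (w.2 - 0) ^ 2)) := by
  rw [← norm_integral_lineChirp, ← norm_integral_lineChirp, ← norm_mul, ← integral_prod_mul,
    ← Measure.volume_eq_prod]
  congr 1
  refine integral_congr_ae (.of_forall fun z => ?_)
  have e : wave w z = Complex.exp (2 * Real.pi * Complex.I * ((-(w.1 * z.1) : ℝ) : ℂ)) *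
      Complex.exp (2 * Real.pi * Complex.I * ((-(w.2 * z.2) : ℝ) : ℂ)) := by
    rw [wave, ← Complex.exp_add]
    congr 1
    push_cast
    ring
  simp only [e, planeChirp]
  ring

lemma rpow_neg_quarter_le (a : ℝ) :
    (1 / 4 + a ^ 2) ^ (-(1 / 4) : ℝ) ≤ 2 * (1 + a ^ 2) ^ (-(1 / 4) : ℝ) := by
  have h1 : (1 / 4 + a ^ 2) ^ (-(1 / 4) : ℝ) ≤ (1 / 4 * (1 + a ^ 2)) ^ (-(1 / 4) : ℝ) :=
    Real.rpow_le_rpow_of_nonpos (by positivity) (by nlinarith [sq_nonneg a]) (by norm_num)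
  refine h1.trans ?_
  rw [Real.mul_rpow (by norm_num) (by positivity)]
  gcongr
  calc (1 / 4 : ℝ) ^ (-(1 / 4) : ℝ) = 4 ^ (1 / 4 : ℝ) := by
        rw [one_div, Real.inv_rpow (by norm_num), Real.rpow_neg (by norm_num), inv_inv]
    _ ≤ 4 ^ (1 / 2 : ℝ) := Real.rpow_le_rpow_of_exponent_le (by norm_num) (by norm_num)
    _ = 2 := by
      rw [← Real.sqrt_eq_rpow, show (4 : ℝ) = 2 ^ 2 by norm_num, Real.sqrt_sq (by norm_num)]

lemma enorm_integral_planeChirp_le (a b c : ℝ) (w : ℝ × ℝ) :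
    ‖∫ z, wave w z * planeChirp a b c z‖ₑ ≤
      ENNReal.ofReal (4 * ((1 + a ^ 2) * (1 + b ^ 2)) ^ (-(1 / 4) : ℝ)) := by
  rw [← ofReal_norm, norm_integral_planeChirp]
  refine ENNReal.ofReal_le_ofReal ?_
  have key (a r : ℝ) : (1 / 4 + a ^ 2) ^ (-(1 / 4) : ℝ) *
      Real.exp (-(Real.pi / 2 / (1 / 4 + a ^ 2)) * r ^ 2) ≤ 2 * (1 + a ^ 2) ^ (-(1 / 4) : ℝ) := by
    refine (mul_le_of_le_one_right (by positivity) ?_).trans (rpow_neg_quarter_le a)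
    rw [Real.exp_le_one_iff, neg_mul]
    have : 0 ≤ Real.pi / 2 / (1 / 4 + a ^ 2) * r ^ 2 := by positivity
    linarith
  refine (mul_le_mul (key a _) (key b _) (by positivity) (by positivity)).trans (le_of_eq ?_)
  rw [Real.mul_rpow (by positivity) (by positivity)]
  ring

/-- Height $(\frac14+a^2)^{-1/4}$ times width of order $(\frac14+a^2)^{1/2}$. -/
lemma lintegral_ofReal_gaussian_le (a c : ℝ) :
    ∫⁻ w, ENNReal.ofReal ((1 / 4 + a ^ 2) ^ (-(1 / 4) : ℝ) *
        Real.exp (-(Real.pi / 2 / (1 / 4 + a ^ 2)) * (w - c) ^ 2)) ≤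
      ENNReal.ofReal (2 * (1 + a ^ 2) ^ (1 / 4 : ℝ)) := by
  have h0 : 0 < 1 / 4 + a ^ 2 := by positivity
  rw [lintegral_sub_right_eq_self (fun w => ENNReal.ofReal ((1 / 4 + a ^ 2) ^ (-(1 / 4) : ℝ) *
        Real.exp (-(Real.pi / 2 / (1 / 4 + a ^ 2)) * w ^ 2))) c,
    ← ofReal_integral_eq_lintegral_ofReal
      ((integrable_exp_neg_mul_sq (by positivity)).const_mul _) (.of_forall fun w => by positivity),
    integral_const_mul, integral_gaussian]
  refine ENNReal.ofReal_le_ofReal ?_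
  have e : Real.pi / (Real.pi / 2 / (1 / 4 + a ^ 2)) = 2 * (1 / 4 + a ^ 2) := by
    field_simp
  rw [e, Real.sqrt_eq_rpow, Real.mul_rpow (by norm_num) h0.le, mul_left_comm,
    ← Real.rpow_add h0]
  have h2 : (2 : ℝ) ^ (1 / 2 : ℝ) ≤ 2 := by
    conv_rhs => rw [← Real.rpow_one 2]
    exact Real.rpow_le_rpow_of_exponent_le (by norm_num) (by norm_num)
  have h3 : (1 / 4 + a ^ 2) ^ (-(1 / 4) + 1 / 2 : ℝ) ≤ (1 + a ^ 2) ^ (1 / 4 : ℝ) := by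
    rw [show (-(1 / 4) + 1 / 2 : ℝ) = 1 / 4 by norm_num]
    exact Real.rpow_le_rpow h0.le (by linarith) (by norm_num)
  gcongr

lemma lintegral_integral_planeChirp_le (a b c : ℝ) :
    ∫⁻ w, ‖∫ z, wave w z * planeChirp a b c z‖ₑ ≤
      ENNReal.ofReal (4 * ((1 + a ^ 2) * (1 + b ^ 2)) ^ (1 / 4 : ℝ)) := by
  simp_rw [← ofReal_norm, norm_integral_planeChirp]
  have e (w : ℝ × ℝ) := ENNReal.ofReal_mul
    (p := (1 / 4 + a ^ 2) ^ (-(1 / 4) : ℝ) *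
        Real.exp (-(Real.pi / 2 / (1 / 4 + a ^ 2)) * (w.1 - c) ^ 2))
    (q := (1 / 4 + b ^ 2) ^ (-(1 / 4) : ℝ) *
        Real.exp (-(Real.pi / 2 / (1 / 4 + b ^ 2)) * (w.2 - 0) ^ 2)) (by positivity)
  simp_rw [e]
  rw [Measure.volume_eq_prod, lintegral_prod_mul
    (f := fun r => ENNReal.ofReal ((1 / 4 + a ^ 2) ^ (-(1 / 4) : ℝ) *
        Real.exp (-(Real.pi / 2 / (1 / 4 + a ^ 2)) * (r - c) ^ 2)))
    (g := fun r => ENNReal.ofReal ((1 / 4 + b ^ 2) ^ (-(1 / 4) : ℝ) *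
        Real.exp (-(Real.pi / 2 / (1 / 4 + b ^ 2)) * (r - 0) ^ 2))) (by fun_prop) (by fun_prop)]
  refine (mul_le_mul' (lintegral_ofReal_gaussian_le a c)
    (lintegral_ofReal_gaussian_le b 0)).trans (le_of_eq ?_)
  rw [← ENNReal.ofReal_mul (by positivity), Real.mul_rpow (by positivity) (by positivity)]
  ring_nf

/-- The Gaussian `e^{-π(s²+t²)/2}`. -/
def wideGaussian : 𝓢(ℝ × ℝ, ℂ) :=
  compCLMOfContinuousLinearEquiv ℂ (LinearEquiv.smulOfNeZero ℝ (ℝ × ℝ) (√(1 / 2))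
    (by positivity)).toContinuousLinearEquiv gaussian2

lemma wideGaussian_apply (z : ℝ × ℝ) : wideGaussian z =
    Complex.exp (-Real.pi / 2 * ((z.1 : ℂ) ^ 2 + (z.2 : ℂ) ^ 2)) := by
  change gaussian2 (√(1 / 2) • z) = _
  rw [gaussian2_apply]
  simp only [Prod.smul_fst, Prod.smul_snd, smul_eq_mul, mul_pow,
    Real.sq_sqrt (show (0 : ℝ) ≤ 1 / 2 by norm_num)]
  push_cast
  congr 1
  ring

/-- The phase `(as² + bt²)/2 + cs`. -/
def chirpPhase (a b c : ℝ) (z : ℝ × ℝ) : ℝ := a / 2 * z.1 ^ 2 + b / 2 * z.2 ^ 2 + c * z.1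

lemma chirpPhase_growth (a b c : ℝ) : (chirpPhase a b c).HasTemperateGrowth := by
  have h1 := growth_fst
  have h2 := growth_snd
  unfold chirpPhase
  fun_prop

/-- The chirped Gaussian `e^{πi(as²+bt²) + 2πics} e^{-π(s²+t²)}`. -/
def chirpGaussian (a b c : ℝ) : 𝓢(ℝ × ℝ, ℂ) := phaseShift (chirpPhase a b c) 0 gaussian2

lemma chirpGaussian_apply (a b c : ℝ) (z : ℝ × ℝ) : chirpGaussian a b c z =
    Complex.exp (2 * Real.pi * Complex.I * (chirpPhase a b c z : ℂ)) * gaussian2 z := by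
  rw [chirpGaussian, phaseShift_apply (chirpPhase_growth a b c), sub_zero]

/-- The Gaussian is split into two equal halves: one makes the chirp integrable, the other stays
behind as a Schwartz function independent of `a`, `b`, `c`. -/
lemma chirpGaussian_eq_mul (a b c : ℝ) (z : ℝ × ℝ) :
    chirpGaussian a b c z = planeChirp a b c z * wideGaussian z := by
  rw [chirpGaussian_apply, gaussian2_apply, wideGaussian_apply, planeChirp, lineChirp, lineChirp,
    Complex.ofReal_exp]
  simp only [← Complex.exp_add, chirpPhase]
  congr 1
  push_cast
  ring

lemma enorm_chirpGaussian (a b c : ℝ) (z : ℝ × ℝ) : ‖chirpGaussian a b c z‖ₑ = ‖gaussian2 z‖ₑ := by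
  rw [chirpGaussian_apply, enorm_mul, ← ofReal_norm, norm_cexp_two_pi, ENNReal.ofReal_one, one_mul]

/-! ### Bounds for `L^p` norms from bounds for `L¹` and `L^∞` norms -/

section Interpolation

variable {α : Type*} [MeasurableSpace α] {μ : Measure α} {V : α → ℂ} {C M : ℝ}

/-- For finite `p`, $|V|^p\le\|V\|_\infty^{p-1}|V|$. At `p = ∞` the term `(p⁻¹).toReal` is $0$, and
the exponent is that of the sup bound. -/
lemma eLpNorm_le_of_enorm_le_of_lintegral_le (hM : 0 < M) (hC : 0 < C)
    (hsup : ∀ x, ‖V x‖ₑ ≤ ENNReal.ofReal (C * M ^ (-(1 / 4) : ℝ)))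
    (hint : ∫⁻ x, ‖V x‖ₑ ∂μ ≤ ENNReal.ofReal (C * M ^ (1 / 4 : ℝ))) {p : ℝ≥0∞} (hp : 1 ≤ p) :
    eLpNorm V p μ ≤ ENNReal.ofReal (C * M ^ ((p⁻¹).toReal / 2 - 1 / 4)) := by
  rcases eq_or_ne p ∞ with rfl | hpt
  · rw [eLpNorm_exponent_top]
    refine (eLpNormEssSup_le_of_ae_enorm_bound (.of_forall hsup)).trans (le_of_eq ?_)
    norm_num
  have hp0 : p ≠ 0 := (zero_lt_one.trans_le hp).ne'
  have hp1 : 1 ≤ p.toReal := by simpa using ENNReal.toReal_mono hpt hp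
  have hpp : 0 < p.toReal := by linarith
  rw [eLpNorm_eq_lintegral_rpow_enorm_toReal hp0 hpt, one_div, ENNReal.rpow_inv_le_iff hpp]
  calc ∫⁻ x, ‖V x‖ₑ ^ p.toReal ∂μ
      ≤ ∫⁻ x, ENNReal.ofReal (C * M ^ (-(1 / 4) : ℝ)) ^ (p.toReal - 1) * ‖V x‖ₑ ∂μ := by
        refine lintegral_mono fun x => ?_
        have e : ‖V x‖ₑ ^ p.toReal = ‖V x‖ₑ ^ (p.toReal - 1) * ‖V x‖ₑ := by
          conv_rhs => rw [← ENNReal.rpow_one ‖V x‖ₑ, ← ENNReal.rpow_mul, one_mul]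
          rw [← ENNReal.rpow_add_of_nonneg _ _ (by linarith) zero_le_one, sub_add_cancel]
        rw [e]
        exact mul_le_mul_left (ENNReal.rpow_le_rpow (hsup x) (by linarith)) _
    _ = ENNReal.ofReal (C * M ^ (-(1 / 4) : ℝ)) ^ (p.toReal - 1) * ∫⁻ x, ‖V x‖ₑ ∂μ :=
        lintegral_const_mul' _ _ (ENNReal.rpow_ne_top_of_nonneg (by linarith) ENNReal.ofReal_ne_top)
    _ ≤ ENNReal.ofReal (C * M ^ (-(1 / 4) : ℝ)) ^ (p.toReal - 1) *
        ENNReal.ofReal (C * M ^ (1 / 4 : ℝ)) := by gcongr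
    _ = _ := by
        rw [ENNReal.ofReal_rpow_of_pos (by positivity), ← ENNReal.ofReal_mul (by positivity),
          ENNReal.ofReal_rpow_of_pos (by positivity), ENNReal.toReal_inv]
        congr 1
        rw [Real.mul_rpow hC.le (by positivity), Real.mul_rpow hC.le (by positivity),
          ← Real.rpow_mul hM.le, ← Real.rpow_mul hM.le]
        have e1 : C ^ p.toReal = C ^ (p.toReal - 1) * C := by
          conv_rhs => rw [← Real.rpow_one C, ← Real.rpow_mul hC.le, one_mul, ← Real.rpow_add hC]
          congr 1
          ring
        -- The exponent balance: $p-1$ factors $M^{-1/4}$ from the sup norm and one factor $M^{1/4}$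
        -- from the $L^1$ norm.
        have e2 : (p.toReal⁻¹ / 2 - 1 / 4) * p.toReal =
            -(1 / 4) * (p.toReal - 1) + 1 / 4 := by
          field_simp
          ring
        rw [e1, e2, Real.rpow_add hM]
        ring

/-- Hölder gives $B\le\|V\|_2^2\le\|V\|_p\|V\|_q$ for the conjugate exponent $q$. Dividing by the
upper bound for $\|V\|_q$ is sharp in $M$, since $\frac1{2q}-\frac14=-(\frac1{2p}-\frac14)$. -/
lemma le_eLpNorm_of_enorm_le_of_lintegral_le (hV : AEStronglyMeasurable V μ) (hM : 0 < M)
    (hC : 0 < C) (hsup : ∀ x, ‖V x‖ₑ ≤ ENNReal.ofReal (C * M ^ (-(1 / 4) : ℝ)))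
    (hint : ∫⁻ x, ‖V x‖ₑ ∂μ ≤ ENNReal.ofReal (C * M ^ (1 / 4 : ℝ))) {B : ℝ}
    (hsq : ENNReal.ofReal B ≤ ∫⁻ x, ‖V x‖ₑ ^ 2 ∂μ) {p : ℝ≥0∞} (hp : 1 ≤ p) :
    ENNReal.ofReal (B / C * M ^ ((p⁻¹).toReal / 2 - 1 / 4)) ≤ eLpNorm V p μ := by
  set q := p.conjExponent with hq
  have hconj : p.HolderConjugate q := ENNReal.HolderConjugate.conjExponent hp
  have hq1 : 1 ≤ q := hconj.symm.one_le
  have hqr : (q⁻¹).toReal = 1 - (p⁻¹).toReal := by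
    have h := hconj.inv_add_inv_eq_one
    have h' := congrArg ENNReal.toReal h
    rw [ENNReal.toReal_add (by simpa using (zero_lt_one.trans_le hp).ne')
      (by simpa using (zero_lt_one.trans_le hq1).ne'), ENNReal.toReal_one] at h'
    linarith
  have hupper := eLpNorm_le_of_enorm_le_of_lintegral_le hM hC hsup hint hq1
  have hholder := eLpNorm_smul_le_mul_eLpNorm (p := p) (q := q) (r := 1) hV hV
  have h1 : ENNReal.ofReal B ≤ eLpNorm V p μ *
      ENNReal.ofReal (C * M ^ ((q⁻¹).toReal / 2 - 1 / 4)) := by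
    refine hsq.trans (le_trans (le_of_eq ?_) (hholder.trans (mul_le_mul' le_rfl hupper)))
    rw [eLpNorm_one_eq_lintegral_enorm]
    refine lintegral_congr fun x => ?_
    simp [enorm_mul, sq]
  have hpos : 0 < C * M ^ ((q⁻¹).toReal / 2 - 1 / 4) := by positivity
  rw [← ENNReal.div_le_iff (by simpa using hpos) ENNReal.ofReal_ne_top,
    ← ENNReal.ofReal_div_of_pos hpos] at h1
  refine le_trans (le_of_eq ?_) h1
  congr 1
  rw [hqr, show (1 - (p⁻¹).toReal) / 2 - 1 / 4 = -((p⁻¹).toReal / 2 - 1 / 4) by ring,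
    Real.rpow_neg hM.le]
  have : M ^ ((p⁻¹).toReal / 2 - 1 / 4) ≠ 0 := (Real.rpow_pos_of_pos hM _).ne'
  field_simp

end Interpolation

/-! ### Coefficient functions as partial Fourier transforms -/

lemma isAddHaarMeasure_volume_prod (E F : Type*) [AddGroup E] [TopologicalSpace E]
    [MeasureSpace E] [AddGroup F] [TopologicalSpace F] [MeasureSpace F] [SFinite (volume : Measure E)]
    [SFinite (volume : Measure F)] [MeasurableAdd E] [MeasurableAdd F]
    [(volume : Measure E).IsAddHaarMeasure] [(volume : Measure F).IsAddHaarMeasure] :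
    (volume : Measure (E × F)).IsAddHaarMeasure :=
  Measure.prod.instIsAddHaarMeasure volume volume

/-- Uniqueness of Haar measure: a linear isomorphism rescales Lebesgue measure. The value of the
factor is immaterial. -/
lemma exists_lintegral_comp_eq (e : (ℝ × ℝ × ℝ × ℝ) ≃L[ℝ] (ℝ × ℝ) × (ℝ × ℝ)) :
    ∃ c : ℝ, 0 < c ∧ ∀ F : (ℝ × ℝ) × (ℝ × ℝ) → ℝ≥0∞, Measurable F →
      ∫⁻ y, F (e y) = ENNReal.ofReal c * ∫⁻ y, F y := by
  have i2 := isAddHaarMeasure_volume_prod ℝ ℝ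
  have i3 := isAddHaarMeasure_volume_prod ℝ (ℝ × ℝ)
  have i4 := isAddHaarMeasure_volume_prod ℝ (ℝ × ℝ × ℝ)
  have i5 := isAddHaarMeasure_volume_prod (ℝ × ℝ) (ℝ × ℝ)
  have hH : (Measure.map e (volume : Measure (ℝ × ℝ × ℝ × ℝ))).IsAddHaarMeasure :=
    e.isAddHaarMeasure_map volume
  have h := Measure.isAddLeftInvariant_eq_smul (Measure.map e volume)
    (volume : Measure ((ℝ × ℝ) × (ℝ × ℝ)))
  refine ⟨((Measure.map e volume).addHaarScalarFactor volume : NNReal),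
    NNReal.coe_pos.2 (Measure.addHaarScalarFactor_pos_of_isAddHaarMeasure (Measure.map e volume)
      (volume : Measure ((ℝ × ℝ) × (ℝ × ℝ)))), fun F hF => ?_⟩
  rw [← lintegral_map hF e.continuous.measurable]
  conv_lhs => rw [h]
  rw [lintegral_smul_measure, ENNReal.ofReal_coe_nnreal]
  rfl

lemma lintegral_sq_pos (K : 𝓢((ℝ × ℝ) × (ℝ × ℝ), ℂ)) (hK : K ≠ 0) :
    ∃ B : ℝ, 0 < B ∧ ENNReal.ofReal B ≤ ∫⁻ y, ‖K y‖ₑ ^ 2 := by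
  have hpos : 0 < ∫⁻ y, ‖K y‖ₑ ^ 2 := by
    refine pos_iff_ne_zero.2 fun h0 => hK ?_
    rw [lintegral_eq_zero_iff (K.continuous.measurable.enorm.pow_const 2)] at h0
    have h1 : (K : (ℝ × ℝ) × (ℝ × ℝ) → ℂ) =ᵐ[volume] fun _ => 0 := by
      filter_upwards [h0] with y hy
      simpa using hy
    have h2 := (K.continuous.ae_eq_iff_eq volume continuous_const).1 h1
    ext y
    exact congrFun h2 y
  obtain ⟨B, hB0, hB⟩ := ENNReal.lt_iff_exists_nnreal_btwn.1 hpos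
  refine ⟨B, by exact_mod_cast hB0, ?_⟩
  rw [ENNReal.ofReal_coe_nnreal]
  exact hB.le

/-- The case $M=1$ of the two interpolation bounds. It shows that the norm held constant along each
family of isometries is finite and nonzero. -/
lemma eLpNorm_partialFourier_comp_bounds (e : (ℝ × ℝ × ℝ × ℝ) ≃L[ℝ] (ℝ × ℝ) × (ℝ × ℝ))
    (K : 𝓢((ℝ × ℝ) × (ℝ × ℝ), ℂ)) (hK : K ≠ 0) {q : ℝ≥0∞} (hq : 1 ≤ q) :
    MemLp (fun y => partialFourier K (e y)) q volume ∧
      eLpNorm (fun y => partialFourier K (e y)) q volume ≠ 0 := by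
  obtain ⟨c, hc, hce⟩ := exists_lintegral_comp_eq e
  obtain ⟨D, hD⟩ := exists_enorm_partialFourier_le K
  obtain ⟨B, hB, hBK⟩ := lintegral_sq_pos K hK
  have hm := stronglyMeasurable_partialFourier K.continuous
  set I := ∫⁻ y, ‖partialFourier K (e y)‖ₑ with hI
  have hIt : I ≠ ∞ := by
    rw [hI, hce _ hm.measurable.enorm]
    exact ENNReal.mul_ne_top ENNReal.ofReal_ne_top (lintegral_enorm_partialFourier_lt_top K).ne
  set C := max 1 (max D I.toReal) with hC
  have hC0 : 0 < C := lt_max_of_lt_left one_pos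
  have hV : AEStronglyMeasurable (fun y => partialFourier K (e y)) volume :=
    (hm.comp_measurable e.continuous.measurable).aestronglyMeasurable
  have h1 : ∀ y, ‖partialFourier K (e y)‖ₑ ≤ ENNReal.ofReal (C * 1 ^ (-(1 / 4) : ℝ)) := by
    intro y
    rw [Real.one_rpow, mul_one]
    exact (hD _).trans (ENNReal.ofReal_le_ofReal (by simp [hC]))
  have h2 : ∫⁻ y, ‖partialFourier K (e y)‖ₑ ≤ ENNReal.ofReal (C * 1 ^ (1 / 4 : ℝ)) := by
    rw [Real.one_rpow, mul_one, ← hI, ← ENNReal.ofReal_toReal hIt]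
    exact ENNReal.ofReal_le_ofReal (by simp [hC])
  have h3 : ENNReal.ofReal (c * B) ≤ ∫⁻ y, ‖partialFourier K (e y)‖ₑ ^ 2 := by
    rw [hce _ (hm.measurable.enorm.pow_const 2), lintegral_sq_partialFourier,
      ENNReal.ofReal_mul hc.le]
    gcongr
  refine ⟨⟨hV, (eLpNorm_le_of_enorm_le_of_lintegral_le one_pos hC0 h1 h2 hq).trans_lt
    ENNReal.ofReal_lt_top⟩, fun h0 => ?_⟩
  have h4 := le_eLpNorm_of_enorm_le_of_lintegral_le hV one_pos hC0 h1 h2 h3 hq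
  rw [h0, Real.one_rpow, mul_one, nonpos_iff_eq_zero, ENNReal.ofReal_eq_zero] at h4
  have : 0 < c * B / C := by positivity
  linarith

lemma pair_coe (ψ χ : 𝓢(ℝ × ℝ, ℂ)) :
    pair (ψ : 𝓢'(ℝ × ℝ, ℂ)) χ = ∫ z, starRingEnd ℂ (χ z) * ψ z := by
  rw [pair, SchwartzMap.coe_apply]
  rfl

lemma conj_cexp_two_pi (r : ℝ) :
    starRingEnd ℂ (Complex.exp (2 * Real.pi * Complex.I * (r : ℂ))) =
      Complex.exp (2 * Real.pi * Complex.I * ((-r : ℝ) : ℂ)) := by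
  rw [← Complex.exp_conj]
  congr 1
  simp [map_ofNat]

/-- The linear automorphism `(z, x) ↦ (z, z - x)`. -/
def diffEquiv : ((ℝ × ℝ) × (ℝ × ℝ)) ≃L[ℝ] (ℝ × ℝ) × (ℝ × ℝ) :=
  LinearEquiv.toContinuousLinearEquiv
    { toFun := fun q => (q.1, q.1 - q.2)
      invFun := fun q => (q.1, q.1 - q.2)
      map_add' := fun q r => by ext <;> simp <;> ring
      map_smul' := fun c q => by ext <;> simp <;> ring
      left_inv := fun q => by simp
      right_inv := fun q => by simp }

/-- The phase `mu (x₁²x₂/2 - x₁x₂s + x₂s²/2)`. -/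
def kernelPhase (mu : ℝ) (q : (ℝ × ℝ) × (ℝ × ℝ)) : ℝ :=
  mu * (1 / 2 * q.2.1 ^ 2 * q.2.2 - q.2.1 * q.2.2 * q.1.1 + 1 / 2 * q.2.2 * q.1.1 ^ 2)

lemma growth_coord :
    (Function.HasTemperateGrowth fun q : (ℝ × ℝ) × (ℝ × ℝ) => q.1.1) ∧
    (Function.HasTemperateGrowth fun q : (ℝ × ℝ) × (ℝ × ℝ) => q.1.2) ∧
    (Function.HasTemperateGrowth fun q : (ℝ × ℝ) × (ℝ × ℝ) => q.2.1) ∧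
    (Function.HasTemperateGrowth fun q : (ℝ × ℝ) × (ℝ × ℝ) => q.2.2) :=
  have h1 := (ContinuousLinearMap.fst ℝ (ℝ × ℝ) (ℝ × ℝ)).hasTemperateGrowth
  have h2 := (ContinuousLinearMap.snd ℝ (ℝ × ℝ) (ℝ × ℝ)).hasTemperateGrowth
  ⟨growth_fst.comp h1, growth_snd.comp h1, growth_fst.comp h2, growth_snd.comp h2⟩

lemma kernelPhase_growth (mu : ℝ) : (kernelPhase mu).HasTemperateGrowth := by
  obtain ⟨h1, h2, h3, h4⟩ := growth_coord
  unfold kernelPhase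
  fun_prop

/-- The Schwartz function `(z, x) ↦ e^{2πi θ(z, x)} ψ(z) conj (g(z - x))`, where `θ` is
`kernelPhase mu`. -/
def kernel (mu : ℝ) (g ψ : 𝓢(ℝ × ℝ, ℂ)) : 𝓢((ℝ × ℝ) × (ℝ × ℝ), ℂ) :=
  SchwartzMap.smulLeftCLM ℂ
    (fun q => Complex.exp (2 * Real.pi * Complex.I * (kernelPhase mu q : ℂ)))
    (compCLMOfContinuousLinearEquiv ℂ diffEquiv (tensor ψ (conjS g)))

lemma kernel_apply (mu : ℝ) (g ψ : 𝓢(ℝ × ℝ, ℂ)) (q : (ℝ × ℝ) × (ℝ × ℝ)) :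
    kernel mu g ψ q = Complex.exp (2 * Real.pi * Complex.I * (kernelPhase mu q : ℂ)) *
      (ψ q.1 * starRingEnd ℂ (g (q.1 - q.2))) := by
  have h : Function.HasTemperateGrowth
      (fun q => Complex.exp (2 * Real.pi * Complex.I * (kernelPhase mu q : ℂ))) :=
    hasTemperateGrowth_cexp.comp (kernelPhase_growth mu)
  rw [kernel, SchwartzMap.smulLeftCLM_apply_apply h]
  rfl

lemma enorm_kernel (mu : ℝ) (g ψ : 𝓢(ℝ × ℝ, ℂ)) (q : (ℝ × ℝ) × (ℝ × ℝ)) :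
    ‖kernel mu g ψ q‖ₑ = ‖ψ q.1‖ₑ * ‖g (q.1 - q.2)‖ₑ := by
  rw [kernel_apply, enorm_mul, enorm_mul, ← ofReal_norm, norm_cexp_two_pi, ENNReal.ofReal_one,
    one_mul, ← ofReal_norm (starRingEnd ℂ _), RCLike.norm_conj, ofReal_norm]

lemma exists_apply_ne_zero {g : 𝓢(ℝ × ℝ, ℂ)} (hg : g ≠ 0) : ∃ z, g z ≠ 0 := by
  by_contra! h
  exact hg (SchwartzMap.ext h)

lemma gaussian2_ne_zero (z : ℝ × ℝ) : gaussian2 z ≠ 0 := by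
  rw [gaussian2_apply]
  exact_mod_cast (Real.exp_pos _).ne'

lemma kernel_gaussian2_ne_zero (mu : ℝ) {g : 𝓢(ℝ × ℝ, ℂ)} (hg : g ≠ 0) :
    kernel mu g gaussian2 ≠ 0 := by
  obtain ⟨z, hz⟩ := exists_apply_ne_zero hg
  intro h
  have h1 := enorm_kernel mu g gaussian2 (0, -z)
  rw [h] at h1
  simp only [zero_sub, neg_neg] at h1
  have h2 : ‖gaussian2 (0 : ℝ × ℝ)‖ₑ * ‖g z‖ₑ = 0 := h1.symm.trans (by simp)
  simp [gaussian2_ne_zero, hz] at h2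

/-- The coordinates `((-mu x₄, -lam x₃), (x₅, x₆))`. -/
def freqEquiv619 {lam mu : ℝ} (hlm : lam * mu ≠ 0) :
    (ℝ × ℝ × ℝ × ℝ) ≃L[ℝ] (ℝ × ℝ) × (ℝ × ℝ) :=
  LinearEquiv.toContinuousLinearEquiv
    { toFun := fun y => ((-(mu * y.2.1), -(lam * y.1)), (y.2.2.1, y.2.2.2))
      invFun := fun q => (-(q.1.2 / lam), -(q.1.1 / mu), q.2.1, q.2.2)
      map_add' := fun q r => by ext <;> simp <;> ring
      map_smul' := fun c q => by ext <;> simp <;> ring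
      left_inv := fun q => by
        have h1 := left_ne_zero_of_mul hlm
        have h2 := right_ne_zero_of_mul hlm
        ext <;> simp <;> field_simp
      right_inv := fun q => by
        have h1 := left_ne_zero_of_mul hlm
        have h2 := right_ne_zero_of_mul hlm
        ext <;> simp <;> field_simp }

/-- On the section the phase is linear in $x_3,x_4$, which act as frequencies dual to $t$ and $s$;
the remaining terms involve only $x_5,x_6,s$ and go into the kernel. -/
lemma coeff_rep619 {lam mu : ℝ} (hlm : lam * mu ≠ 0) (g ψ : 𝓢(ℝ × ℝ, ℂ)) (y : ℝ × ℝ × ℝ × ℝ) :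
    coeff (rep619 lam mu) g (ψ : 𝓢'(ℝ × ℝ, ℂ)) (G619.sec y) =
      partialFourier (kernel mu g ψ) (freqEquiv619 hlm y) := by
  rw [coeff, pair_coe, partialFourier]
  refine integral_congr_ae (.of_forall fun z => ?_)
  have e1 : rep619 lam mu (G619.sec y) g z =
      Complex.exp (2 * Real.pi * Complex.I * (phase619 lam mu (G619.sec y) z : ℂ)) *
        g (z - (y.2.2.1, y.2.2.2)) := phaseShift_apply (phase619_growth lam mu _) _ g z
  have e2 : freqEquiv619 hlm y = ((-(mu * y.2.1), -(lam * y.1)), (y.2.2.1, y.2.2.2)) := rfl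
  have e3 : Complex.exp (2 * Real.pi * Complex.I * ((-phase619 lam mu (G619.sec y) z : ℝ) : ℂ)) =
      wave (-(mu * y.2.1), -(lam * y.1)) z * Complex.exp (2 * Real.pi * Complex.I *
        (kernelPhase mu (z, (y.2.2.1, y.2.2.2)) : ℂ)) := by
    rw [wave, ← Complex.exp_add]
    congr 1
    simp only [phase619, kernelPhase, G619.sec]
    push_cast
    ring
  simp only [e1, e2, map_mul, conj_cexp_two_pi, kernel_apply, e3]
  ring

/-- The same kernel without phase; `swap` exchanges position and frequency. -/
lemma stft_coe (g ψ : 𝓢(ℝ × ℝ, ℂ)) (y : (ℝ × ℝ) × (ℝ × ℝ)) :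
    stft g (ψ : 𝓢'(ℝ × ℝ, ℂ)) y = partialFourier (kernel 0 g ψ) y.swap := by
  rw [stft, pair_coe, partialFourier]
  refine integral_congr_ae (.of_forall fun z => ?_)
  simp only [timeFreqShift_apply, map_mul, conj_cexp_two_pi, kernel_apply, wave, kernelPhase,
    Prod.fst_swap, Prod.snd_swap, zero_mul, Complex.ofReal_zero, mul_zero, Complex.exp_zero,
    one_mul]
  ring

/-! ### Coefficients of chirped Gaussians for `G_{6,19}` -/

/-- The chirp depends on `z` alone, so it multiplies a kernel that is the same for all `a`, `b`,
`c`. -/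
lemma kernel_chirpGaussian (mu a b c : ℝ) (g : 𝓢(ℝ × ℝ, ℂ)) :
    (kernel mu g (chirpGaussian a b c) : (ℝ × ℝ) × (ℝ × ℝ) → ℂ) =
      fun q => planeChirp a b c q.1 * kernel mu g wideGaussian q := by
  ext q
  simp only [kernel_apply, chirpGaussian_eq_mul]
  ring

/-- The central estimate. The constants are uniform in `a`, `b`, `c`, and even in `p`. -/
theorem exists_eLpNorm_coeff_chirpGaussian_bounds {lam mu : ℝ} (hlm : lam * mu ≠ 0)
    {g : 𝓢(ℝ × ℝ, ℂ)} (hg : g ≠ 0) : ∃ C B : ℝ, 0 < C ∧ 0 < B ∧ ∀ a b c : ℝ, ∀ p : ℝ≥0∞, 1 ≤ p →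
      AEStronglyMeasurable (fun y => coeff (rep619 lam mu) g
        (chirpGaussian a b c : 𝓢'(ℝ × ℝ, ℂ)) (G619.sec y)) volume ∧
      eLpNorm (fun y => coeff (rep619 lam mu) g
        (chirpGaussian a b c : 𝓢'(ℝ × ℝ, ℂ)) (G619.sec y)) p volume ≤
        ENNReal.ofReal (C * ((1 + a ^ 2) * (1 + b ^ 2)) ^ ((p⁻¹).toReal / 2 - 1 / 4)) ∧
      ENNReal.ofReal (B * ((1 + a ^ 2) * (1 + b ^ 2)) ^ ((p⁻¹).toReal / 2 - 1 / 4)) ≤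
        eLpNorm (fun y => coeff (rep619 lam mu) g
          (chirpGaussian a b c : 𝓢'(ℝ × ℝ, ℂ)) (G619.sec y)) p volume := by
  set e := freqEquiv619 hlm
  set K := kernel mu g wideGaussian with hK
  obtain ⟨r, hr, hre⟩ := exists_lintegral_comp_eq e
  obtain ⟨D, hD0, hD⟩ := exists_forall_fibreNorm_le K
  -- The $L^2$ lower bound comes from the unchirped Gaussian, whose kernel has the same modulus as
  -- that of every chirped one.
  obtain ⟨B, hB, hBK⟩ := lintegral_sq_pos _ (kernel_gaussian2_ne_zero mu hg)
  set I := ∫⁻ x, fibreNorm K x with hI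
  have hIt : I ≠ ∞ := (lintegral_fibreNorm_lt_top K).ne
  -- The 4 is the constant of the two chirp bounds; `D` and `I` are the sup and the integral of
  -- `fibreNorm`, and `r` is the Jacobian factor.
  set C := max 1 (max (4 * D) (r * (4 * I.toReal))) with hC
  have hC0 : 0 < C := lt_max_of_lt_left one_pos
  refine ⟨C, r * B / C, hC0, by positivity, fun a b c p hp => ?_⟩
  set M := (1 + a ^ 2) * (1 + b ^ 2) with hM
  have hM0 : 0 < M := by positivity
  simp only [coeff_rep619 hlm, kernel_chirpGaussian]
  have hm := stronglyMeasurable_partialFourier (K := fun q => planeChirp a b c q.1 * K q)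
    (((continuous_planeChirp a b c).comp continuous_fst).mul K.continuous)
  have hV : AEStronglyMeasurable
      (fun y => partialFourier (fun q => planeChirp a b c q.1 * K q) (e y)) volume :=
    (hm.comp_measurable e.continuous.measurable).aestronglyMeasurable
  have h1 : ∀ y, ‖partialFourier (fun q => planeChirp a b c q.1 * K q) (e y)‖ₑ ≤
      ENNReal.ofReal (C * M ^ (-(1 / 4) : ℝ)) := by
    intro y
    refine (enorm_partialFourier_mul_le (integrable_planeChirp a b c)
      (enorm_integral_planeChirp_le a b c) K _).trans ((mul_le_mul' le_rfl (hD _)).trans ?_)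
    rw [← ENNReal.ofReal_mul (by positivity)]
    refine ENNReal.ofReal_le_ofReal ?_
    rw [mul_right_comm]
    gcongr
    simp [hC]
  have h2 : ∫⁻ y, ‖partialFourier (fun q => planeChirp a b c q.1 * K q) (e y)‖ₑ ≤
      ENNReal.ofReal (C * M ^ (1 / 4 : ℝ)) := by
    rw [hre _ hm.measurable.enorm]
    refine (mul_le_mul' le_rfl ((lintegral_enorm_partialFourier_mul_le
      (integrable_planeChirp a b c) (continuous_planeChirp a b c) K).trans
      (mul_le_mul' (lintegral_integral_planeChirp_le a b c) le_rfl))).trans ?_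
    rw [← hI, ← ENNReal.ofReal_toReal hIt, ← ENNReal.ofReal_mul (by positivity),
      ← ENNReal.ofReal_mul (by positivity)]
    refine ENNReal.ofReal_le_ofReal ?_
    rw [show r * (4 * M ^ (1 / 4 : ℝ) * I.toReal) = r * (4 * I.toReal) * M ^ (1 / 4 : ℝ) by ring]
    gcongr
    simp [hC]
  have h3 : ENNReal.ofReal (r * B) ≤
      ∫⁻ y, ‖partialFourier (fun q => planeChirp a b c q.1 * K q) (e y)‖ₑ ^ 2 := by
    rw [hre _ (hm.measurable.enorm.pow_const 2), ← kernel_chirpGaussian,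
      lintegral_sq_partialFourier, ENNReal.ofReal_mul hr.le]
    gcongr
    refine hBK.trans (le_of_eq (lintegral_congr fun q => ?_))
    rw [enorm_kernel, enorm_kernel, enorm_chirpGaussian]
  exact ⟨hV, eLpNorm_le_of_enorm_le_of_lintegral_le hM0 hC0 h1 h2 hp,
    le_eLpNorm_of_enorm_le_of_lintegral_le hV hM0 hC0 h1 h2 h3 hp⟩

/-! ### Coefficients of the Gaussian for `G_{5,3}` -/

/-- The polynomial automorphism `((s, t), x) ↦ ((s - t²/2 + x₁, t), (s - t²/2, t - x₂))`. -/
def shear53 (q : (ℝ × ℝ) × (ℝ × ℝ)) : (ℝ × ℝ) × (ℝ × ℝ) :=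
  ((q.1.1 - 1 / 2 * q.1.2 ^ 2 + q.2.1, q.1.2), (q.1.1 - 1 / 2 * q.1.2 ^ 2, q.1.2 - q.2.2))

lemma hasTemperateGrowth_prodMk {E F G : Type*} [NormedAddCommGroup E] [NormedSpace ℝ E]
    [NormedAddCommGroup F] [NormedSpace ℝ F] [NormedAddCommGroup G] [NormedSpace ℝ G]
    {f : E → F} {h : E → G} (hf : f.HasTemperateGrowth) (hh : h.HasTemperateGrowth) :
    Function.HasTemperateGrowth fun x => (f x, h x) := by
  have h1 := (ContinuousLinearMap.inl ℝ F G).hasTemperateGrowth.comp hf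
  have h2 := (ContinuousLinearMap.inr ℝ F G).hasTemperateGrowth.comp hh
  have := h1.add h2
  convert this using 1
  ext x <;> simp

lemma shear53_growth : shear53.HasTemperateGrowth := by
  obtain ⟨h1, h2, h3, h4⟩ := growth_coord
  unfold shear53
  refine hasTemperateGrowth_prodMk (hasTemperateGrowth_prodMk ?_ ?_)
    (hasTemperateGrowth_prodMk ?_ ?_) <;> fun_prop

/-- The inverse of the shear is quadratic: $t$ is read off directly, then $s$, $x_1$ and $x_2$. Such
properness is what composition of Schwartz functions with `shear53` requires. -/
lemma norm_le_shear53 (q : (ℝ × ℝ) × (ℝ × ℝ)) : ‖q‖ ≤ 2 * (1 + ‖shear53 q‖) ^ 2 := by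
  obtain ⟨⟨s, t⟩, x₁, x₂⟩ := q
  set N := ‖shear53 ((s, t), (x₁, x₂))‖ with hN
  have hN0 : 0 ≤ N := norm_nonneg _
  have h1 : |s - 1 / 2 * t ^ 2 + x₁| ≤ N :=
    (norm_fst_le (shear53 ((s, t), (x₁, x₂))).1).trans (norm_fst_le _)
  have h2 : |t| ≤ N := (norm_snd_le (shear53 ((s, t), (x₁, x₂))).1).trans (norm_fst_le _)
  have h3 : |s - 1 / 2 * t ^ 2| ≤ N :=
    (norm_fst_le (shear53 ((s, t), (x₁, x₂))).2).trans (norm_snd_le _)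
  have h4 : |t - x₂| ≤ N := (norm_snd_le (shear53 ((s, t), (x₁, x₂))).2).trans (norm_snd_le _)
  have h5 : t ^ 2 ≤ N ^ 2 := sq_le_sq' (by linarith [neg_abs_le t]) (by linarith [le_abs_self t])
  rw [abs_le] at h1 h2 h3 h4
  simp only [Prod.norm_def, Real.norm_eq_abs, max_le_iff, abs_le]
  refine ⟨⟨⟨?_, ?_⟩, ?_, ?_⟩, ⟨?_, ?_⟩, ?_, ?_⟩ <;> nlinarith

/-- The Schwartz function `(z, x) ↦ (ψ ⊗ conj g) (shear53 (z, x))`. -/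
def kernel53 (g ψ : 𝓢(ℝ × ℝ, ℂ)) : 𝓢((ℝ × ℝ) × (ℝ × ℝ), ℂ) :=
  compCLM ℂ shear53_growth ⟨2, 2, norm_le_shear53⟩ (tensor ψ (conjS g))

lemma kernel53_apply (g ψ : 𝓢(ℝ × ℝ, ℂ)) (q : (ℝ × ℝ) × (ℝ × ℝ)) :
    kernel53 g ψ q = ψ (shear53 q).1 * starRingEnd ℂ (g (shear53 q).2) := rfl

lemma kernel53_gaussian2_ne_zero {g : 𝓢(ℝ × ℝ, ℂ)} (hg : g ≠ 0) : kernel53 g gaussian2 ≠ 0 := by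
  obtain ⟨z, hz⟩ := exists_apply_ne_zero hg
  intro h
  have h1 := kernel53_apply g gaussian2 ((z.1, 0), (0, -z.2))
  rw [h] at h1
  have e : (shear53 ((z.1, 0), (0, -z.2))).2 = z := by ext <;> simp [shear53]
  rw [e] at h1
  simp [gaussian2_ne_zero, hz] at h1

/-- The shear `(s, t) ↦ (s - t²/2 + r, t)` of the plane. -/
def shearPlane (r : ℝ) : (ℝ × ℝ) ≃ₜ ℝ × ℝ where
  toFun z := (z.1 - 1 / 2 * z.2 ^ 2 + r, z.2)
  invFun z := (z.1 + 1 / 2 * z.2 ^ 2 - r, z.2)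
  left_inv z := by ext <;> simp only; ring
  right_inv z := by ext <;> simp only; ring
  continuous_toFun := by fun_prop
  continuous_invFun := by fun_prop

/-- On each line with fixed second coordinate the map is a translation. -/
lemma measurePreserving_add_fst {β : Type*} [MeasureSpace β] [SFinite (volume : Measure β)]
    {h : β → ℝ} (hh : Measurable h) :
    MeasurePreserving (fun p : ℝ × β => (p.1 + h p.2, p.2)) volume volume := by
  have h1 : MeasurePreserving (fun p : β × ℝ => (p.1, p.2 + h p.1))
      (volume.prod volume) (volume.prod volume) := by
    refine (MeasurePreserving.id volume).skew_product
      (g := fun b s => s + h b) ?_ (.of_forall fun b => ?_)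
    · exact measurable_snd.add (hh.comp measurable_fst)
    · exact (measurePreserving_add_right volume _).map_eq
  exact (Measure.measurePreserving_swap.comp h1).comp Measure.measurePreserving_swap

lemma measurePreserving_shearPlane (r : ℝ) : MeasurePreserving (shearPlane r) volume volume := by
  have h := measurePreserving_add_fst (h := fun t : ℝ => -(1 / 2) * t ^ 2 + r) (by fun_prop)
  convert h using 1
  funext z
  change (z.1 - 1 / 2 * z.2 ^ 2 + r, z.2) = (z.1 + (-(1 / 2) * z.2 ^ 2 + r), z.2)
  congr 1
  ring

/-- The coordinates `((x₄, -x₂), (x₃, x₅))`. -/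
def freqEquiv53 : (ℝ × ℝ × ℝ × ℝ) ≃L[ℝ] (ℝ × ℝ) × (ℝ × ℝ) :=
  LinearEquiv.toContinuousLinearEquiv
    { toFun := fun y => ((y.2.2.1, -y.1), (y.2.1, y.2.2.2))
      invFun := fun q => (-q.1.2, q.2.1, q.1.1, q.2.2)
      map_add' := fun q r => by ext <;> simp; ring
      map_smul' := fun c q => by ext <;> simp
      left_inv := fun q => by simp
      right_inv := fun q => by simp }

/-- The phase contains $x_4(s+\frac12t^2-x_3)$. Substituting $s\mapsto s-\frac12t^2+x_3$ straightens
it to $x_4s-x_2t$, which is linear in $z$, so the coefficient becomes a partial Fourier transform.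
-/
lemma coeff_rep53 (g ψ : 𝓢(ℝ × ℝ, ℂ)) (y : ℝ × ℝ × ℝ × ℝ) :
    coeff (rep53 1) g (ψ : 𝓢'(ℝ × ℝ, ℂ)) (G53.sec y) =
      partialFourier (kernel53 g ψ) (freqEquiv53 y) := by
  rw [coeff, pair_coe, partialFourier,
    ← (measurePreserving_shearPlane y.2.1).integral_comp (shearPlane y.2.1).measurableEmbedding]
  refine integral_congr_ae (.of_forall fun z => ?_)
  have e1 (z) : rep53 1 (G53.sec y) g z =
      Complex.exp (2 * Real.pi * Complex.I * (phase53 1 (G53.sec y) z : ℂ)) *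
        g (z - (y.2.1, y.2.2.2)) := phaseShift_apply (phase53_growth 1 _) _ g z
  have e2 : freqEquiv53 y = ((y.2.2.1, -y.1), (y.2.1, y.2.2.2)) := rfl
  have e3 : shearPlane y.2.1 z - (y.2.1, y.2.2.2) = (shear53 (z, (y.2.1, y.2.2.2))).2 := by
    ext <;> simp [shearPlane, shear53]
  have e4 : shearPlane y.2.1 z = (shear53 (z, (y.2.1, y.2.2.2))).1 := rfl
  simp only [e1, e2, map_mul, conj_cexp_two_pi, kernel53_apply, wave, e3]
  rw [mul_assoc, mul_comm (ψ _), e4]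
  congr 3
  simp only [phase53, G53.sec, shear53]
  push_cast
  ring

/-! ### Absolutely convergent series of tempered distributions -/

lemma summable_norm_lp_one (c : lp (fun _ : ℕ => ℂ) 1) : Summable fun n => ‖c n‖ := by
  simpa using (lp.memℓp c).summable (by simp)

lemma norm_lp_one (c : lp (fun _ : ℕ => ℂ) 1) : ‖c‖ = ∑' n, ‖c n‖ := by
  simpa using lp.norm_eq_tsum_rpow (by simp) c

lemma summable_lp_one_mul (c : lp (fun _ : ℕ => ℂ) 1) {a : ℕ → ℂ} {A : ℝ} (ha : ∀ n, ‖a n‖ ≤ A) :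
    Summable fun n => c n * a n := by
  refine Summable.of_norm_bounded ((summable_norm_lp_one c).mul_right A) fun n => ?_
  rw [norm_mul]
  exact mul_le_mul_of_nonneg_left (ha n) (norm_nonneg _)

lemma norm_tsum_lp_one_mul_le (c : lp (fun _ : ℕ => ℂ) 1) {a : ℕ → ℂ} {A : ℝ}
    (ha : ∀ n, ‖a n‖ ≤ A) : ‖∑' n, c n * a n‖ ≤ ‖c‖ * A := by
  rw [norm_lp_one, ← tsum_mul_right]
  refine tsum_of_norm_bounded ((summable_norm_lp_one c).mul_right A).hasSum fun n => ?_
  rw [norm_mul]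
  exact mul_le_mul_of_nonneg_left (ha n) (norm_nonneg _)

lemma tendsto_tsum_lp_one_mul {u : ℕ → lp (fun _ : ℕ => ℂ) 1} {c : lp (fun _ : ℕ => ℂ) 1}
    (hu : Filter.Tendsto u Filter.atTop (nhds c)) {a : ℕ → ℂ} {A : ℝ} (ha : ∀ n, ‖a n‖ ≤ A) :
    Filter.Tendsto (fun k => ∑' n, u k n * a n) Filter.atTop (nhds (∑' n, c n * a n)) := by
  rw [tendsto_iff_norm_sub_tendsto_zero] at hu ⊢
  refine squeeze_zero (fun _ => norm_nonneg _) (fun k => ?_) (by simpa using hu.mul_const A)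
  rw [← (summable_lp_one_mul (u k) ha).tsum_sub (summable_lp_one_mul c ha)]
  have h := norm_tsum_lp_one_mul_le (u k - c) ha
  simpa [sub_mul] using h

/-- The sum `∑ c_n h_n` of tempered distributions dominated by a single Schwartz seminorm, for an
absolutely summable sequence of coefficients. -/
def tsumDistribution (h : ℕ → 𝓢'(ℝ × ℝ, ℂ)) {s : Finset (ℕ × ℕ)} {C : NNReal}
    (hh : ∀ n ψ, ‖h n ψ‖ ≤ C * s.sup (schwartzSeminormFamily ℂ (ℝ × ℝ) ℂ) ψ)
    (c : lp (fun _ : ℕ => ℂ) 1) : 𝓢'(ℝ × ℝ, ℂ) :=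
  let T : 𝓢(ℝ × ℝ, ℂ) →ₗ[ℂ] ℂ :=
    { toFun := fun ψ => ∑' n, c n * h n ψ
      map_add' := fun ψ χ => by
        rw [← (summable_lp_one_mul c (hh · ψ)).tsum_add (summable_lp_one_mul c (hh · χ))]
        simp [mul_add]
      map_smul' := fun r ψ => by
        rw [RingHom.id_apply, smul_eq_mul, ← tsum_mul_left]
        refine tsum_congr fun n => ?_
        rw [map_smul, smul_eq_mul]
        ring }
  ContinuousLinearMap.toPointwiseConvergenceCLM ℂ (RingHom.id ℂ) 𝓢(ℝ × ℝ, ℂ) ℂ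
    ⟨T, (schwartz_withSeminorms ℂ (ℝ × ℝ) ℂ).continuous_normedSpace_rng ℂ T
      ⟨s, ‖c‖₊ * C, fun ψ => by
        have := norm_tsum_lp_one_mul_le c (hh · ψ)
        rw [← mul_assoc] at this
        exact this⟩⟩

lemma tsumDistribution_apply (h : ℕ → 𝓢'(ℝ × ℝ, ℂ)) {s : Finset (ℕ × ℕ)} {C : NNReal}
    (hh : ∀ n ψ, ‖h n ψ‖ ≤ C * s.sup (schwartzSeminormFamily ℂ (ℝ × ℝ) ℂ) ψ)
    (c : lp (fun _ : ℕ => ℂ) 1) (ψ : 𝓢(ℝ × ℝ, ℂ)) :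
    tsumDistribution h hh c ψ = ∑' n, c n * h n ψ := rfl

/-- If every tempered distribution `f` with `(y ↦ pair f (α y)) ∈ L^p` satisfies
`(y ↦ pair f (β y)) ∈ L^q`, then a dominated sequence of distributions which is bounded for the
first norm is bounded for the second. -/
theorem exists_forall_eLpNorm_pair_le {X Y : Type*} [MeasureSpace X] [MeasureSpace Y]
    {α : X → 𝓢(ℝ × ℝ, ℂ)} {β : Y → 𝓢(ℝ × ℝ, ℂ)} {p q : ℝ≥0∞} (hp : 1 ≤ p) (hq : 1 ≤ q)
    (hsub : ∀ f : 𝓢'(ℝ × ℝ, ℂ), MemLp (fun x => pair f (α x)) p volume →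
      MemLp (fun y => pair f (β y)) q volume)
    {h : ℕ → 𝓢'(ℝ × ℝ, ℂ)} {s : Finset (ℕ × ℕ)} {C : NNReal}
    (hh : ∀ n ψ, ‖h n ψ‖ ≤ C * s.sup (schwartzSeminormFamily ℂ (ℝ × ℝ) ℂ) ψ)
    (hα : ∀ n, AEStronglyMeasurable (fun x => pair (h n) (α x)) volume) {D : NNReal}
    (hD : ∀ n, eLpNorm (fun x => pair (h n) (α x)) p volume ≤ D) :
    ∃ D' : NNReal, ∀ n, eLpNorm (fun y => pair (h n) (β y)) q volume ≤ D' := by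
  have hp' : Fact (1 ≤ p) := ⟨hp⟩
  have hq' : Fact (1 ≤ q) := ⟨hq⟩
  have hmem (n) : MemLp (fun x => pair (h n) (α x)) p volume :=
    ⟨hα n, (hD n).trans_lt ENNReal.coe_lt_top⟩
  -- The series of coefficients converges absolutely in $L^p$, hence almost everywhere to its $L^p$
  -- sum; pointwise it is the coefficient of the distribution $\sum c_nh_n$.
  have hX (c : lp (fun _ : ℕ => ℂ) 1) :
      MemLp (fun x => pair (tsumDistribution h hh c) (α x)) p volume := by
    set F : ℕ → Lp ℂ p (volume : Measure X) := fun n => c n • (hmem n).toLp _ with hF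
    have hFn (n) : ‖F n‖ ≤ ‖c n‖ * D := by
      rw [hF, norm_smul, Lp.norm_toLp]
      gcongr
      exact ENNReal.toReal_le_of_le_ofReal D.2 (by simpa using! hD n)
    have hsum : Summable fun n => ‖F n‖ :=
      Summable.of_nonneg_of_le (fun _ => norm_nonneg _) hFn ((summable_norm_lp_one c).mul_right _)
    have hs := Lp.hasSum_coeFn_tsum (f := F) (tsum_enorm_ne_top_iff_summable_norm.2 hsum)
    have hc : ∀ᵐ x, ∀ n, F n x = c n * pair (h n) (α x) := by
      refine ae_all_iff.2 fun n => ?_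
      filter_upwards [Lp.coeFn_smul (c n) ((hmem n).toLp _), (hmem n).coeFn_toLp] with x h1 h2
      rw [hF]
      simp [h1, h2]
    refine (memLp_congr_ae ?_).1 (Lp.memLp (∑' n, F n))
    filter_upwards [hs, hc] with x h1 h2
    rw [← h1.tsum_eq, pair, tsumDistribution_apply]
    exact tsum_congr h2
  let T : lp (fun _ : ℕ => ℂ) 1 →ₗ[ℂ] Lp ℂ q (volume : Measure Y) :=
    { toFun := fun c => (hsub _ (hX c)).toLp _
      map_add' := fun c d => by
        rw [← MemLp.toLp_add]
        congr 1
        ext y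
        simp only [Pi.add_apply, pair, tsumDistribution_apply]
        rw [← (summable_lp_one_mul c (hh · _)).tsum_add (summable_lp_one_mul d (hh · _))]
        simp [add_mul]
      map_smul' := fun r c => by
        rw [RingHom.id_apply, ← MemLp.toLp_const_smul]
        congr 1
        ext y
        simp only [Pi.smul_apply, pair, tsumDistribution_apply, smul_eq_mul, ← tsum_mul_left]
        simp [mul_assoc] }
  have hT (c) : T c =ᵐ[volume] fun y => pair (tsumDistribution h hh c) (β y) :=
    (hsub _ (hX c)).coeFn_toLp
  -- Closed graph: along a subsequence the $L^q$ limit holds almost everywhere, while convergence in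
  -- $\ell^1$ gives convergence of the coefficients at every point, by domination of the $h_n$.
  have hgraph : ∀ (u : ℕ → lp (fun _ : ℕ => ℂ) 1) (c : lp (fun _ : ℕ => ℂ) 1)
      (G : Lp ℂ q (volume : Measure Y)), Filter.Tendsto u Filter.atTop (nhds c) →
      Filter.Tendsto (T ∘ u) Filter.atTop (nhds G) → G = T c := by
    intro u c G hu hG
    obtain ⟨ns, hns, hlim⟩ := (tendstoInMeasure_of_tendsto_Lp hG).exists_seq_tendsto_ae
    refine Lp.ext ?_
    have hall : ∀ᵐ y, ∀ n, T (u n) y = pair (tsumDistribution h hh (u n)) (β y) :=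
      ae_all_iff.2 fun n => hT (u n)
    filter_upwards [hlim, hall, hT c] with y h1 h2 h3
    rw [h3]
    refine tendsto_nhds_unique h1 ?_
    have h4 : (fun i => (T ∘ u) (ns i) y) = fun i => ∑' n, u (ns i) n * h n (conjS (β y)) :=
      funext fun i => h2 (ns i)
    rw [h4]
    exact (tendsto_tsum_lp_one_mul hu (hh · _)).comp hns.tendsto_atTop
  let S := ContinuousLinearMap.ofSeqClosedGraph hgraph
  refine ⟨‖S‖₊, fun n => ?_⟩
  -- The unit vectors of $\ell^1$ have norm one and are sent to the coefficients of the $h_n$.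
  have h1 : T (lp.single 1 n 1) = S (lp.single 1 n 1) := rfl
  have h2 := S.le_opNorm (lp.single 1 n 1)
  rw [lp.norm_single (by simp), norm_one, mul_one, ← h1] at h2
  have h3 (y) : pair (tsumDistribution h hh (lp.single 1 n 1)) (β y) = pair (h n) (β y) := by
    rw [pair, tsumDistribution_apply, tsum_eq_single n fun k hk => by
      rw [lp.single_apply_ne _ _ _ hk, zero_mul], lp.single_apply_self, one_mul]
    rfl
  have h4 : eLpNorm (T (lp.single 1 n 1)) q volume =
      eLpNorm (fun y => pair (h n) (β y)) q volume := by
    refine eLpNorm_congr_ae ?_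
    filter_upwards [hT (lp.single 1 n 1)] with y hy
    rw [hy, h3]
  rw [← h4, ← ENNReal.ofReal_toReal (Lp.eLpNorm_ne_top (T (lp.single 1 n 1))), ← Lp.norm_def,
    ← ENNReal.ofReal_coe_nnreal]
  exact ENNReal.ofReal_le_ofReal h2

/-! ### Comparing two families of coefficients -/

/-- Suppose the `L^p` norm of the first coefficients of `f_n` is comparable to
`M_n^{1/(2p) - 1/4}` with `M_n → ∞`, while the `L^q` norm of the second ones is constant. Then the
two coefficient conditions define different spaces of distributions if `p ≠ 2`. -/
theorem not_forall_memLp_pair_iff {X Y : Type*} [MeasureSpace X] [MeasureSpace Y]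
    {α : X → 𝓢(ℝ × ℝ, ℂ)} {β : Y → 𝓢(ℝ × ℝ, ℂ)} {p q : ℝ≥0∞} (hp : 1 ≤ p) (hq : 1 ≤ q)
    (hp2 : p ≠ 2) {f : ℕ → 𝓢'(ℝ × ℝ, ℂ)} {M : ℕ → ℝ} (hM : ∀ n, 1 ≤ M n)
    (hMt : Filter.Tendsto M Filter.atTop Filter.atTop)
    {s : Finset (ℕ × ℕ)} {C : NNReal}
    (hdom : ∀ n ψ, ‖f n ψ‖ ≤
      M n ^ (-(1 / 4) : ℝ) * (C * s.sup (schwartzSeminormFamily ℂ (ℝ × ℝ) ℂ) ψ))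
    {A B : ℝ} (hB0 : 0 < B)
    (hα : ∀ n, AEStronglyMeasurable (fun x => pair (f n) (α x)) volume)
    (hA : ∀ n, eLpNorm (fun x => pair (f n) (α x)) p volume ≤
      ENNReal.ofReal (A * M n ^ ((p⁻¹).toReal / 2 - 1 / 4)))
    (hB : ∀ n, ENNReal.ofReal (B * M n ^ ((p⁻¹).toReal / 2 - 1 / 4)) ≤
      eLpNorm (fun x => pair (f n) (α x)) p volume)
    {b : ℝ≥0∞} (hb0 : b ≠ 0) (hbt : b ≠ ∞)
    (hβ : ∀ n, AEStronglyMeasurable (fun y => pair (f n) (β y)) volume)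
    (hb : ∀ n, eLpNorm (fun y => pair (f n) (β y)) q volume = b) :
    ¬ ∀ h : 𝓢'(ℝ × ℝ, ℂ), MemLp (fun x => pair h (α x)) p volume ↔
      MemLp (fun y => pair h (β y)) q volume := by
  intro hiff
  set r := (p⁻¹).toReal with hr
  have hp0 : p ≠ 0 := (zero_lt_one.trans_le hp).ne'
  have hr0 : 0 ≤ r := ENNReal.toReal_nonneg
  have hM0 (n) : 0 < M n := zero_lt_one.trans_le (hM n)
  have hMinv (n) : M n ^ (-(1 / 4) : ℝ) ≤ 1 :=
    Real.rpow_le_one_of_one_le_of_nonpos (hM n) (by norm_num)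
  have hnn (ψ) : 0 ≤ C * s.sup (schwartzSeminormFamily ℂ (ℝ × ℝ) ℂ) ψ := by positivity
  have hr2 : r ≠ 1 / 2 := by
    intro h
    apply hp2
    have h1 : p⁻¹ = ENNReal.ofReal (1 / 2) := by
      rw [← h, hr, ENNReal.ofReal_toReal (ENNReal.inv_ne_top.2 hp0)]
    rw [one_div, ENNReal.ofReal_inv_of_pos two_pos, inv_inj] at h1
    simpa using h1
  have hcontra (κ : ℝ) (hκ : 0 < κ) (c : ℝ) (hc : 0 < c) (D : NNReal)
      (hle : ∀ n, ENNReal.ofReal (c * M n ^ κ) ≤ D) : False := by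
    have ht : Filter.Tendsto (fun n => c * M n ^ κ) Filter.atTop Filter.atTop :=
      ((tendsto_rpow_atTop hκ).comp hMt).const_mul_atTop hc
    obtain ⟨n, hn⟩ := (ht.eventually_gt_atTop (D : ℝ)).exists
    have h1 := hle n
    rw [← ENNReal.ofReal_coe_nnreal, ENNReal.ofReal_le_ofReal_iff D.coe_nonneg] at h1
    linarith
  -- For $p>2$ the first norms decay: rescaled to be bounded, the sequence blows up in the second
  -- norm. For $p<2$ the first norms already blow up against the constant second norm.
  rcases lt_or_gt_of_ne hr2 with hlt | hgt
  · set κ := 1 / 4 - r / 2 with hκ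
    have hκ0 : 0 < κ := by linarith
    set h : ℕ → 𝓢'(ℝ × ℝ, ℂ) := fun n => ((M n ^ κ : ℝ) : ℂ) • f n with hh
    have hpow (n) : 0 < M n ^ κ := Real.rpow_pos_of_pos (hM0 n) _
    have hen (n) : ‖((M n ^ κ : ℝ) : ℂ)‖ₑ = ENNReal.ofReal (M n ^ κ) := by
      rw [← ofReal_norm, Complex.norm_real, Real.norm_of_nonneg (hpow n).le]
    have hsα (n) : (fun x => pair (h n) (α x)) =
        ((M n ^ κ : ℝ) : ℂ) • fun x => pair (f n) (α x) := rfl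
    have hsβ (n) : (fun y => pair (h n) (β y)) =
        ((M n ^ κ : ℝ) : ℂ) • fun y => pair (f n) (β y) := rfl
    obtain ⟨D, hD⟩ : ∃ D : NNReal, ∀ n, eLpNorm (fun y => pair (h n) (β y)) q volume ≤ D := by
      refine exists_forall_eLpNorm_pair_le hp hq (fun f => (hiff f).1) (h := h)
        (s := s) (C := C) (fun n ψ => ?_) (fun n => ?_) (D := A.toNNReal) (fun n => ?_)
      · have e : ‖h n ψ‖ = M n ^ κ * ‖f n ψ‖ := by
          change ‖((M n ^ κ : ℝ) : ℂ) * f n ψ‖ = _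
          rw [norm_mul, Complex.norm_real, Real.norm_of_nonneg (hpow n).le]
        rw [e]
        refine (mul_le_mul_of_nonneg_left (hdom n ψ) (hpow n).le).trans ?_
        rw [← mul_assoc, ← Real.rpow_add (hM0 n)]
        -- The rescaling costs $M^\kappa$ with $\kappa\le\frac14$, which the decay $M^{-1/4}$ in
        -- $\mathcal S'$ absorbs.
        exact mul_le_of_le_one_left (hnn ψ)
          (Real.rpow_le_one_of_one_le_of_nonpos (hM n) (by linarith))
      · rw [hsα]
        exact (hα n).const_smul _
      · rw [hsα, eLpNorm_const_smul, hen]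
        refine (mul_le_mul' le_rfl (hA n)).trans (le_of_eq ?_)
        rw [← ENNReal.ofReal_mul (hpow n).le, mul_left_comm, ← Real.rpow_add (hM0 n),
          show κ + (r / 2 - 1 / 4) = 0 by rw [hκ]; ring, Real.rpow_zero, mul_one]
        rfl
    refine hcontra κ hκ0 b.toReal (ENNReal.toReal_pos hb0 hbt) D fun n => ?_
    refine le_trans (le_of_eq ?_) (hD n)
    rw [hsβ, eLpNorm_const_smul, hb, hen, ENNReal.ofReal_mul ENNReal.toReal_nonneg,
      ENNReal.ofReal_toReal hbt, mul_comm]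
  · obtain ⟨D, hD⟩ := exists_forall_eLpNorm_pair_le hq hp (fun f => (hiff f).2) (h := f)
      (s := s) (C := C) (fun n ψ => (hdom n ψ).trans (mul_le_of_le_one_left (hnn ψ) (hMinv n)))
      hβ (D := b.toNNReal) (fun n => by rw [hb, ENNReal.coe_toNNReal hbt])
    exact hcontra (r / 2 - 1 / 4) (by linarith) B hB0 D fun n => (hB n).trans (hD n)

/-! ### Isometries -/

lemma eLpNorm_unimodular_mul {Y : Type*} [MeasurableSpace Y] {μ : Measure Y} {θ V : Y → ℂ}
    (hθ : ∀ y, ‖θ y‖ = 1) (p : ℝ≥0∞) : eLpNorm (fun y => θ y * V y) p μ = eLpNorm V p μ :=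
  eLpNorm_congr_norm_ae (.of_forall fun y => by simp [hθ])

lemma memLp_unimodular_mul_comp {Y : Type*} [MeasurableSpace Y] {μ : Measure Y} {θ V : Y → ℂ}
    {τ : Y → Y} (hθ : ∀ y, ‖θ y‖ = 1) (hθm : AEStronglyMeasurable θ μ)
    (hτ : MeasurePreserving τ μ μ) {p : ℝ≥0∞} (hV : MemLp V p μ) :
    MemLp (fun y => θ y * V (τ y)) p μ ∧
      eLpNorm (fun y => θ y * V (τ y)) p μ = eLpNorm V p μ := by
  have h1 : eLpNorm (fun y => θ y * V (τ y)) p μ = eLpNorm V p μ := by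
    rw [eLpNorm_unimodular_mul hθ]
    exact eLpNorm_comp_measurePreserving hV.1 hτ
  exact ⟨⟨hθm.mul (hV.1.comp_measurePreserving hτ), h1 ▸ hV.2⟩, h1⟩

lemma pair_smul_right (f : 𝓢'(ℝ × ℝ, ℂ)) (c : ℂ) (ψ : 𝓢(ℝ × ℝ, ℂ)) :
    pair f (c • ψ) = starRingEnd ℂ c * pair f ψ := by
  rw [pair, map_smulₛₗ, map_smul]
  rfl

lemma measurePreserving_add_right_prod (v : ℝ × ℝ × ℝ × ℝ) :
    MeasurePreserving (fun y : ℝ × ℝ × ℝ × ℝ => y + v) volume volume := by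
  have i2 := isAddHaarMeasure_volume_prod ℝ ℝ
  have i3 := isAddHaarMeasure_volume_prod ℝ (ℝ × ℝ)
  have i4 := isAddHaarMeasure_volume_prod ℝ (ℝ × ℝ × ℝ)
  exact measurePreserving_add_right volume v

/-- Left translation by the inverse of $(0,0,0,u,0)$ moves the section by $-u$ in $x_4$, up to the
central element $-ux_3$, which acts by a scalar. -/
lemma coeff_distRep_rep53 (g : 𝓢(ℝ × ℝ, ℂ)) (f : 𝓢'(ℝ × ℝ, ℂ)) (u : ℝ) (y : ℝ × ℝ × ℝ × ℝ) :
    coeff (rep53 1) g (distRep (rep53 1) ⟨0, 0, 0, u, 0⟩ f) (G53.sec y) =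
      Complex.exp (2 * Real.pi * Complex.I * ((u * y.2.1 : ℝ) : ℂ)) *
        coeff (rep53 1) g f (G53.sec (y + (0, 0, -u, 0))) := by
  have h1 : (⟨0, 0, 0, u, 0⟩ : G53)⁻¹ * G53.sec y =
      ⟨-(u * y.2.1), 0, 0, 0, 0⟩ * G53.sec (y + (0, 0, -u, 0)) := by
    ext <;> simp [G53.mul_def, G53.inv_def, G53.sec]
    ring
  have h2 (r : ℝ) (ψ : 𝓢(ℝ × ℝ, ℂ)) : rep53 1 ⟨r, 0, 0, 0, 0⟩ ψ =
      Complex.exp (2 * Real.pi * Complex.I * (r : ℂ)) • ψ := by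
    ext z
    have e : rep53 1 ⟨r, 0, 0, 0, 0⟩ ψ z =
      Complex.exp (2 * Real.pi * Complex.I * (phase53 1 ⟨r, 0, 0, 0, 0⟩ z : ℂ)) *
        ψ (z - (0, 0)) := phaseShift_apply (phase53_growth 1 _) _ ψ z
    have hz : z - (0, 0) = z := sub_zero z
    rw [e, hz]
    simp [phase53]
  rw [coeff, pair_distRep, ← mul_apply_eq_comp, ← map_mul, h1, map_mul, mul_apply_eq_comp, h2,
    pair_smul_right, conj_cexp_two_pi, neg_neg]
  rfl

lemma memLp_coeff_distRep_rep53 {g : 𝓢(ℝ × ℝ, ℂ)} {f : 𝓢'(ℝ × ℝ, ℂ)} {q : ℝ≥0∞}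
    (hf : MemLp (fun y => coeff (rep53 1) g f (G53.sec y)) q volume) (u : ℝ) :
    MemLp (fun y => coeff (rep53 1) g (distRep (rep53 1) ⟨0, 0, 0, u, 0⟩ f) (G53.sec y)) q volume ∧
      eLpNorm (fun y => coeff (rep53 1) g (distRep (rep53 1) ⟨0, 0, 0, u, 0⟩ f) (G53.sec y)) q
        volume = eLpNorm (fun y => coeff (rep53 1) g f (G53.sec y)) q volume := by
  simp only [coeff_distRep_rep53]
  exact memLp_unimodular_mul_comp (fun y => norm_cexp_two_pi _)
    (Continuous.aestronglyMeasurable (by fun_prop)) (measurePreserving_add_right_prod _) hf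

lemma distRep_rep53_gaussian2 (u : ℝ) :
    distRep (rep53 1) ⟨0, 0, 0, u, 0⟩ (gaussian2 : 𝓢'(ℝ × ℝ, ℂ)) =
      (chirpGaussian 0 u u : 𝓢'(ℝ × ℝ, ℂ)) := by
  rw [distRep_coe]
  congr 1
  ext z
  have e : rep53 1 ⟨0, 0, 0, u, 0⟩ gaussian2 z =
      Complex.exp (2 * Real.pi * Complex.I * (phase53 1 ⟨0, 0, 0, u, 0⟩ z : ℂ)) *
        gaussian2 (z - (0, 0)) := phaseShift_apply (phase53_growth 1 _) _ gaussian2 z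
  have hz : z - (0, 0) = z := sub_zero z
  rw [e, hz, chirpGaussian_apply]
  congr 4
  simp only [phase53, chirpPhase]
  ring

/-! ### Translates of the Gaussian in the second variable -/

/-- The translate `e^{-π(s² + (t-v)²)}` of the Gaussian. -/
def translatedGaussian (v : ℝ) : 𝓢(ℝ × ℝ, ℂ) := compSubConstCLM ℂ (0, v) gaussian2

lemma translatedGaussian_apply (v : ℝ) (z : ℝ × ℝ) :
    translatedGaussian v z = gaussian2 (z - (0, v)) := by
  simp [translatedGaussian]

/-- Translating the integration variable replaces $x_6$ by $x_6-v$. The terms of the phase carrying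
$x_6$ leave behind $\mu v(\frac12x_5^2-x_5s+\frac12s^2)$: the first is a scalar phase, the second
shifts $x_4$ by $-vx_5$, the third is the chirp. -/
lemma coeff_rep619_translatedGaussian (lam mu : ℝ) (g : 𝓢(ℝ × ℝ, ℂ)) (v : ℝ)
    (y : ℝ × ℝ × ℝ × ℝ) :
    coeff (rep619 lam mu) g (translatedGaussian v : 𝓢'(ℝ × ℝ, ℂ)) (G619.sec y) =
      Complex.exp (2 * Real.pi * Complex.I *
        ((lam * y.1 * v + 1 / 2 * mu * v * y.2.2.1 ^ 2 : ℝ) : ℂ)) *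
        coeff (rep619 lam mu) g (chirpGaussian (mu * v) 0 0 : 𝓢'(ℝ × ℝ, ℂ))
          (G619.sec (y.1, y.2.1 + -v * y.2.2.1, y.2.2.1, y.2.2.2 + -v)) := by
  have e1 (y) (z) : rep619 lam mu (G619.sec y) g z =
      Complex.exp (2 * Real.pi * Complex.I * (phase619 lam mu (G619.sec y) z : ℂ)) *
        g (z - (y.2.2.1, y.2.2.2)) := phaseShift_apply (phase619_growth lam mu _) _ g z
  rw [coeff, coeff, pair_coe, pair_coe,
    ← integral_add_right_eq_self _ ((0, v) : ℝ × ℝ), ← integral_const_mul]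
  refine integral_congr_ae (.of_forall fun z => ?_)
  have e2 : z + (0, v) - (y.2.2.1, y.2.2.2) = z - (y.2.2.1, y.2.2.2 + -v) := by
    ext <;> simp; ring
  have e3 : Complex.exp (2 * Real.pi * Complex.I *
        ((-phase619 lam mu (G619.sec y) (z + (0, v)) : ℝ) : ℂ)) =
      Complex.exp (2 * Real.pi * Complex.I *
        ((lam * y.1 * v + 1 / 2 * mu * v * y.2.2.1 ^ 2 : ℝ) : ℂ)) *
      Complex.exp (2 * Real.pi * Complex.I * ((-phase619 lam mu
        (G619.sec (y.1, y.2.1 + -v * y.2.2.1, y.2.2.1, y.2.2.2 + -v)) z : ℝ) : ℂ)) *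
      Complex.exp (2 * Real.pi * Complex.I * (chirpPhase (mu * v) 0 0 z : ℂ)) := by
    rw [← Complex.exp_add, ← Complex.exp_add]
    congr 1
    simp only [phase619, chirpPhase, G619.sec, Prod.fst_add, Prod.snd_add]
    push_cast
    ring
  simp only [e1, map_mul, conj_cexp_two_pi, translatedGaussian_apply, add_sub_cancel_right,
    chirpGaussian_apply, e2, e3]
  ring

lemma eLpNorm_coeff_rep619_translatedGaussian {lam mu : ℝ} (hlm : lam * mu ≠ 0)
    (g : 𝓢(ℝ × ℝ, ℂ)) (v : ℝ) (p : ℝ≥0∞) :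
    eLpNorm (fun y => coeff (rep619 lam mu) g (translatedGaussian v : 𝓢'(ℝ × ℝ, ℂ))
        (G619.sec y)) p volume =
      eLpNorm (fun y => coeff (rep619 lam mu) g (chirpGaussian (mu * v) 0 0 : 𝓢'(ℝ × ℝ, ℂ))
        (G619.sec y)) p volume := by
  simp only [coeff_rep619_translatedGaussian]
  rw [eLpNorm_unimodular_mul fun y => norm_cexp_two_pi _]
  have h1 : MeasurePreserving
      (fun y : ℝ × ℝ × ℝ × ℝ => (y.1, y.2.1 + -v * y.2.2.1, y.2.2.1, y.2.2.2)) volume volume :=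
    (MeasurePreserving.id (volume : Measure ℝ)).prod
      (measurePreserving_add_fst (h := fun x : ℝ × ℝ => -v * x.1) (by fun_prop))
  have h2 := (measurePreserving_add_right_prod (0, 0, 0, -v)).comp h1
  have h3 : AEStronglyMeasurable (fun y => coeff (rep619 lam mu) g
      (chirpGaussian (mu * v) 0 0 : 𝓢'(ℝ × ℝ, ℂ)) (G619.sec y)) volume := by
    simp only [coeff_rep619 hlm]
    exact ((stronglyMeasurable_partialFourier (SchwartzMap.continuous _)).comp_measurable
      (freqEquiv619 hlm).continuous.measurable).aestronglyMeasurable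
  rw [← eLpNorm_comp_measurePreserving h3 h2]
  congr 1
  funext y
  have e : (y.1, y.2.1 + -v * y.2.2.1, y.2.2.1, y.2.2.2) + (0, 0, 0, -v) =
      (y.1, y.2.1 + -v * y.2.2.1, y.2.2.1, y.2.2.2 + -v) := by
    ext <;> simp
  simp only [Function.comp_apply, e]

lemma stft_translatedGaussian (g : 𝓢(ℝ × ℝ, ℂ)) (v : ℝ) (y : (ℝ × ℝ) × (ℝ × ℝ)) :
    stft g (translatedGaussian v : 𝓢'(ℝ × ℝ, ℂ)) y =
      Complex.exp (2 * Real.pi * Complex.I * ((-(y.2.2 * v) : ℝ) : ℂ)) *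
        stft g (gaussian2 : 𝓢'(ℝ × ℝ, ℂ)) (y.1 - (0, v), y.2) := by
  rw [stft, stft, pair_coe, pair_coe,
    ← integral_add_right_eq_self _ ((0, v) : ℝ × ℝ), ← integral_const_mul]
  refine integral_congr_ae (.of_forall fun z => ?_)
  have e2 : z + (0, v) - y.1 = z - (y.1 - (0, v)) := by abel
  have e3 : Complex.exp (2 * Real.pi * Complex.I *
        ((-(y.2.1 * (z + (0, v)).1 + y.2.2 * (z + (0, v)).2) : ℝ) : ℂ)) =
      Complex.exp (2 * Real.pi * Complex.I * ((-(y.2.2 * v) : ℝ) : ℂ)) *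
      Complex.exp (2 * Real.pi * Complex.I * ((-(y.2.1 * z.1 + y.2.2 * z.2) : ℝ) : ℂ)) := by
    rw [← Complex.exp_add]
    congr 1
    simp only [Prod.fst_add, Prod.snd_add]
    push_cast
    ring
  simp only [timeFreqShift_apply, map_mul, conj_cexp_two_pi, translatedGaussian_apply,
    add_sub_cancel_right, e2, e3]
  ring

/-- By covariance of the short-time Fourier transform, a translate changes it only by a phase and a
translation, so one norm `b` serves all `v`. -/
lemma stft_translatedGaussian_comp (g : 𝓢(ℝ × ℝ, ℂ)) (hg : g ≠ 0) {q : ℝ≥0∞} (hq : 1 ≤ q) :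
    ∃ b : ℝ≥0∞, b ≠ 0 ∧ b ≠ ∞ ∧ ∀ v : ℝ,
      AEStronglyMeasurable (stft g (translatedGaussian v : 𝓢'(ℝ × ℝ, ℂ))) volume ∧
      eLpNorm (stft g (translatedGaussian v : 𝓢'(ℝ × ℝ, ℂ))) q volume = b := by
  let e : (ℝ × ℝ × ℝ × ℝ) ≃L[ℝ] (ℝ × ℝ) × (ℝ × ℝ) :=
    (ContinuousLinearEquiv.prodAssoc ℝ ℝ ℝ (ℝ × ℝ)).symm
  obtain ⟨hm, h0⟩ := eLpNorm_partialFourier_comp_bounds e _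
    (kernel_gaussian2_ne_zero 0 hg) hq
  have he : MeasurePreserving e volume volume :=
    (measurePreserving_prodAssoc (volume : Measure ℝ) (volume : Measure ℝ)
      (volume : Measure (ℝ × ℝ))).symm
  have hK := stronglyMeasurable_partialFourier (kernel 0 g gaussian2).continuous
  have hcomp : eLpNorm (fun y => partialFourier (kernel 0 g gaussian2) (e y)) q volume =
      eLpNorm (partialFourier (kernel 0 g gaussian2)) q volume :=
    eLpNorm_comp_measurePreserving hK.aestronglyMeasurable he
  have hs : stft g (gaussian2 : 𝓢'(ℝ × ℝ, ℂ)) =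
      partialFourier (kernel 0 g gaussian2) ∘ Prod.swap := funext fun y => stft_coe g gaussian2 y
  have hswap : MeasurePreserving (Prod.swap : (ℝ × ℝ) × (ℝ × ℝ) → _) volume volume :=
    Measure.measurePreserving_swap
  have hsm : MemLp (stft g (gaussian2 : 𝓢'(ℝ × ℝ, ℂ))) q volume := by
    rw [hs]
    exact MemLp.comp_measurePreserving ⟨hK.aestronglyMeasurable, hcomp ▸ hm.2⟩ hswap
  have hsn : eLpNorm (stft g (gaussian2 : 𝓢'(ℝ × ℝ, ℂ))) q volume ≠ 0 := by
    rw [hs, eLpNorm_comp_measurePreserving hK.aestronglyMeasurable hswap, ← hcomp]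
    exact h0
  refine ⟨_, hsn, hsm.2.ne, fun v => ?_⟩
  have i2 := isAddHaarMeasure_volume_prod ℝ ℝ
  have hτ : MeasurePreserving (fun y : (ℝ × ℝ) × (ℝ × ℝ) => (y.1 - (0, v), y.2)) volume volume :=
    (measurePreserving_sub_right volume ((0, v) : ℝ × ℝ)).prod (MeasurePreserving.id volume)
  have h := memLp_unimodular_mul_comp
    (θ := fun y => Complex.exp (2 * Real.pi * Complex.I * ((-(y.2.2 * v) : ℝ) : ℂ)))
    (fun y => norm_cexp_two_pi _) (Continuous.aestronglyMeasurable (by fun_prop)) hτ hsm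
  rw [show stft g (translatedGaussian v : 𝓢'(ℝ × ℝ, ℂ)) = _ from
    funext fun y => stft_translatedGaussian g v y]
  exact ⟨h.1.1, h.2⟩

/-! ### Decay of the two families in the space of tempered distributions -/

/-- The pairing is the Fourier transform at $0$ of the chirp times a Schwartz function, so the sup
bound $M^{-1/4}$ applies. -/
lemma exists_norm_chirpGaussian_apply_le : ∃ (s : Finset (ℕ × ℕ)) (C : NNReal),
    ∀ (a b c : ℝ) (ψ : 𝓢(ℝ × ℝ, ℂ)), ‖(chirpGaussian a b c : 𝓢'(ℝ × ℝ, ℂ)) ψ‖ ≤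
      ((1 + a ^ 2) * (1 + b ^ 2)) ^ (-(1 / 4) : ℝ) *
        (C * s.sup (schwartzSeminormFamily ℂ (ℝ × ℝ) ℂ) ψ) := by
  obtain ⟨s, C, hC⟩ := exists_lintegral_enorm_clm_le
    (planeFourier ∘L SchwartzMap.smulLeftCLM ℂ wideGaussian)
  refine ⟨s, 4 * C, fun a b c ψ => ?_⟩
  have hT (z : ℝ × ℝ) : SchwartzMap.smulLeftCLM ℂ wideGaussian ψ z = wideGaussian z * ψ z :=
    SchwartzMap.smulLeftCLM_apply_apply wideGaussian.hasTemperateGrowth ψ z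
  have h1 : (chirpGaussian a b c : 𝓢'(ℝ × ℝ, ℂ)) ψ =
      ∫ z, wave 0 z * (planeChirp a b c z * SchwartzMap.smulLeftCLM ℂ wideGaussian ψ z) := by
    rw [SchwartzMap.coe_apply]
    refine integral_congr_ae (.of_forall fun z => ?_)
    simp only [hT, smul_eq_mul, chirpGaussian_eq_mul, wave]
    simp
    ring
  have h2 := enorm_integral_wave_mul_mul_le (integrable_planeChirp a b c)
    (enorm_integral_planeChirp_le a b c) (SchwartzMap.smulLeftCLM ℂ wideGaussian ψ) 0
  have h3 := h2.trans (mul_le_mul' le_rfl (hC ψ))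
  rw [← h1, ← ofReal_norm, ← ENNReal.ofReal_coe_nnreal, ← ENNReal.ofReal_mul C.coe_nonneg,
    ← ENNReal.ofReal_mul (by positivity), ENNReal.ofReal_le_ofReal_iff (by positivity)] at h3
  refine h3.trans (le_of_eq ?_)
  push_cast
  ring

/-- Rapid decay of the test function makes the pairing with a translate $O((1+|v|)^{-1})$, more than
the required order $|v|^{-1/2}$. -/
lemma exists_norm_translatedGaussian_apply_le (mu : ℝ) : ∃ (s : Finset (ℕ × ℕ)) (C : NNReal),
    ∀ (v : ℝ) (ψ : 𝓢(ℝ × ℝ, ℂ)), ‖(translatedGaussian v : 𝓢'(ℝ × ℝ, ℂ)) ψ‖ ≤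
      (1 + (mu * v) ^ 2) ^ (-(1 / 4) : ℝ) *
        (C * s.sup (schwartzSeminormFamily ℂ (ℝ × ℝ) ℂ) ψ) := by
  set J := ∫ z : ℝ × ℝ, (1 + ‖z‖) * ‖gaussian2 z‖ with hJ
  have hJi : Integrable fun z : ℝ × ℝ => (1 + ‖z‖) * ‖gaussian2 z‖ := by
    have h1 := gaussian2.integrable_pow_mul volume 1
    have h0 := (gaussian2.integrable (μ := volume)).norm
    refine (h0.add h1).congr (.of_forall fun z => ?_)
    simp
    ring
  have hJ0 : 0 ≤ J := integral_nonneg fun z => by positivity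
  refine ⟨Finset.Iic (1, 0), ⟨(1 + |mu|) * (2 * J), by positivity⟩, fun v ψ => ?_⟩
  set S := (Finset.Iic (1, 0)).sup (schwartzSeminormFamily ℂ (ℝ × ℝ) ℂ) ψ with hS
  have hS0 : 0 ≤ S := apply_nonneg _ _
  have hψ (z : ℝ × ℝ) : (1 + ‖z‖) * ‖ψ z‖ ≤ 2 * S := by
    have h : (1 + ‖z‖) ^ 1 * ‖iteratedFDeriv ℝ 0 ψ z‖ ≤ 2 ^ 1 * S :=
      one_add_le_sup_seminorm_apply (𝕜 := ℂ) (m := (1, 0)) (le_refl 1) (le_refl 0) ψ z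
    rwa [pow_one, pow_one, norm_iteratedFDeriv_zero] at h
  -- Peetre's inequality: the weight in `v` is shared between the test function and the Gaussian.
  have hv (z : ℝ × ℝ) : 1 + |v| ≤ (1 + ‖z + (0, v)‖) * (1 + ‖z‖) := by
    have h1 : |v| ≤ ‖z + (0, v)‖ + ‖z‖ := by
      calc |v| = ‖((0, v) : ℝ × ℝ)‖ := by simp [Prod.norm_def]
        _ = ‖(z + (0, v)) - z‖ := by simp
        _ ≤ _ := norm_sub_le _ _
    nlinarith [norm_nonneg z, norm_nonneg (z + (0, v))]
  have hmain : (1 + |v|) * ‖(translatedGaussian v : 𝓢'(ℝ × ℝ, ℂ)) ψ‖ ≤ 2 * S * J := by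
    rw [SchwartzMap.coe_apply, ← integral_add_right_eq_self _ ((0, v) : ℝ × ℝ)]
    simp only [translatedGaussian_apply, add_sub_cancel_right]
    have hv0 : 0 < 1 + |v| := by positivity
    rw [← le_div_iff₀' hv0]
    refine (norm_integral_le_of_norm_le ((hJi.const_mul (2 * S)).div_const (1 + |v|))
      (.of_forall fun z => ?_)).trans (le_of_eq ?_)
    · rw [le_div_iff₀' hv0, norm_smul]
      calc (1 + |v|) * (‖ψ (z + (0, v))‖ * ‖gaussian2 z‖)
          ≤ ((1 + ‖z + (0, v)‖) * (1 + ‖z‖)) * (‖ψ (z + (0, v))‖ * ‖gaussian2 z‖) := by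
            gcongr
            exact hv z
        _ = ((1 + ‖z + (0, v)‖) * ‖ψ (z + (0, v))‖) * ((1 + ‖z‖) * ‖gaussian2 z‖) := by ring
        _ ≤ 2 * S * ((1 + ‖z‖) * ‖gaussian2 z‖) := by
            exact mul_le_mul_of_nonneg_right (hψ _) (by positivity)
    · rw [integral_div, integral_const_mul]
  have hpow : (1 + (mu * v) ^ 2) ^ (1 / 4 : ℝ) ≤ (1 + |mu|) * (1 + |v|) := by
    have h1 : 1 + (mu * v) ^ 2 ≤ ((1 + |mu|) * (1 + |v|)) ^ 4 := by
      have h2 : 1 + (mu * v) ^ 2 ≤ (1 + |mu| * |v|) ^ 2 := by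
        rw [← sq_abs (mu * v), abs_mul]
        nlinarith [abs_nonneg mu, abs_nonneg v, mul_nonneg (abs_nonneg mu) (abs_nonneg v)]
      have h3 : 1 + |mu| * |v| ≤ (1 + |mu|) * (1 + |v|) := by
        nlinarith [abs_nonneg mu, abs_nonneg v]
      have h4 : 1 ≤ (1 + |mu|) * (1 + |v|) := by
        nlinarith [abs_nonneg mu, abs_nonneg v, mul_nonneg (abs_nonneg mu) (abs_nonneg v)]
      calc 1 + (mu * v) ^ 2 ≤ (1 + |mu| * |v|) ^ 2 := h2
        _ ≤ ((1 + |mu|) * (1 + |v|)) ^ 2 := by gcongr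
        _ ≤ _ := pow_le_pow_right₀ h4 (by norm_num)
    calc (1 + (mu * v) ^ 2) ^ (1 / 4 : ℝ)
        ≤ (((1 + |mu|) * (1 + |v|)) ^ 4) ^ (1 / 4 : ℝ) := by gcongr
      _ = _ := by
        rw [← Real.rpow_natCast, ← Real.rpow_mul (by positivity)]
        norm_num
  have hP : 0 < (1 + (mu * v) ^ 2) ^ (1 / 4 : ℝ) := by positivity
  rw [Real.rpow_neg (by positivity), ← div_eq_inv_mul, le_div_iff₀' hP]
  calc (1 + (mu * v) ^ 2) ^ (1 / 4 : ℝ) * ‖(translatedGaussian v : 𝓢'(ℝ × ℝ, ℂ)) ψ‖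
      ≤ (1 + |mu|) * (1 + |v|) * ‖(translatedGaussian v : 𝓢'(ℝ × ℝ, ℂ)) ψ‖ := by gcongr
    _ = (1 + |mu|) * ((1 + |v|) * ‖(translatedGaussian v : 𝓢'(ℝ × ℝ, ℂ)) ψ‖) := by ring
    _ ≤ (1 + |mu|) * (2 * S * J) := by gcongr
    _ = (1 + |mu|) * (2 * J) * S := by ring

/-! ### The two spaces differ from the coorbit space of `G_{6,19}` -/

lemma tendsto_one_add_sq {r : ℝ} (hr : r ≠ 0) :
    Filter.Tendsto (fun n : ℕ => 1 + (r * (n : ℝ)) ^ 2) Filter.atTop Filter.atTop := by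
  have h1 : Filter.Tendsto (fun n : ℕ => r ^ 2 * (n : ℝ) ^ 2) Filter.atTop Filter.atTop :=
    ((Filter.tendsto_pow_atTop two_ne_zero).comp tendsto_natCast_atTop_atTop).const_mul_atTop
      (by positivity)
  refine Filter.tendsto_atTop_add_const_left _ 1 ?_
  simpa only [mul_pow] using h1

theorem coorbit_rep619_ne_modulationSpace {lam mu : ℝ} (hlm : lam * mu ≠ 0) {p q : ℝ≥0∞}
    (hp : 1 ≤ p) (hq : 1 ≤ q) (hp2 : p ≠ 2) {g g' : 𝓢(ℝ × ℝ, ℂ)} (hg : g ≠ 0) (hg' : g' ≠ 0) :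
    coorbit (rep619 lam mu) G619.sec g p ≠ modulationSpace g' q := by
  intro heq
  obtain ⟨A, B, -, hB0, hAB⟩ := exists_eLpNorm_coeff_chirpGaussian_bounds hlm hg
  obtain ⟨b, hb0, hbt, hb⟩ := stft_translatedGaussian_comp g' hg' hq
  obtain ⟨s, C, hC⟩ := exists_norm_translatedGaussian_apply_le mu
  have hnorm (n : ℕ) := eLpNorm_coeff_rep619_translatedGaussian hlm g n p
  refine not_forall_memLp_pair_iff (A := A) (B := B) (α := fun y => rep619 lam mu (G619.sec y) g)
    (β := fun y : (ℝ × ℝ) × (ℝ × ℝ) => timeFreqShift y.1 y.2 g') hp hq hp2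
    (f := fun n => (translatedGaussian n : 𝓢'(ℝ × ℝ, ℂ))) (M := fun n => 1 + (mu * n) ^ 2)
    (fun n => le_add_of_nonneg_right (sq_nonneg _))
    (tendsto_one_add_sq (right_ne_zero_of_mul hlm)) (fun n ψ => hC n ψ) hB0 (fun n => ?_)
    (fun n => ?_) (fun n => ?_) hb0 hbt (fun n => (hb n).1) (fun n => (hb n).2)
    (fun f => Submodule.ext_iff.1 heq f)
  · have : (fun y => pair (translatedGaussian n : 𝓢'(ℝ × ℝ, ℂ)) (rep619 lam mu (G619.sec y) g)) =
        fun y => partialFourier (kernel mu g (translatedGaussian n)) (freqEquiv619 hlm y) :=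
      funext fun y => coeff_rep619 hlm g _ y
    rw [this]
    exact ((stronglyMeasurable_partialFourier (SchwartzMap.continuous _)).comp_measurable
      (freqEquiv619 hlm).continuous.measurable).aestronglyMeasurable
  · have h := (hAB (mu * n) 0 0 p hp).2.1
    rw [← hnorm] at h
    simpa using! h
  · have h := (hAB (mu * n) 0 0 p hp).2.2
    rw [← hnorm] at h
    simpa using! h

theorem coorbit_rep619_ne_coorbit_rep53 {lam mu : ℝ} (hlm : lam * mu ≠ 0) {p q : ℝ≥0∞}
    (hp : 1 ≤ p) (hq : 1 ≤ q) (hp2 : p ≠ 2) {g g' : 𝓢(ℝ × ℝ, ℂ)} (hg : g ≠ 0) (hg' : g' ≠ 0) :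
    coorbit (rep619 lam mu) G619.sec g p ≠ coorbit (rep53 1) G53.sec g' q := by
  intro heq
  obtain ⟨A, B, -, hB0, hAB⟩ := exists_eLpNorm_coeff_chirpGaussian_bounds hlm hg
  obtain ⟨s, C, hC⟩ := exists_norm_chirpGaussian_apply_le
  obtain ⟨hm, h0⟩ := eLpNorm_partialFourier_comp_bounds freqEquiv53 _
    (kernel53_gaussian2_ne_zero hg') hq
  simp only [← coeff_rep53] at hm h0
  have hiso (u : ℝ) := memLp_coeff_distRep_rep53 hm u
  simp only [distRep_rep53_gaussian2] at hiso
  refine not_forall_memLp_pair_iff (A := A) (B := B) (α := fun y => rep619 lam mu (G619.sec y) g)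
    (β := fun y => rep53 1 (G53.sec y) g') hp hq hp2
    (f := fun n => (chirpGaussian 0 n n : 𝓢'(ℝ × ℝ, ℂ))) (M := fun n => 1 + (1 * n) ^ 2)
    (fun n => le_add_of_nonneg_right (sq_nonneg _))
    (tendsto_one_add_sq one_ne_zero) (s := s) (C := C) (fun n ψ => ?_) hB0
    (fun n => (hAB 0 n n p hp).1) (fun n => ?_) (fun n => ?_) h0 hm.2.ne
    (fun n => (hiso n).1.1) (fun n => (hiso n).2) (fun f => Submodule.ext_iff.1 heq f)
  · simpa using hC 0 n n ψ
  · simpa using! (hAB 0 n n p hp).2.1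
  · simpa using! (hAB 0 n n p hp).2.2

end Coorbit

end

/-! ### Assembly of the theorem -/

theorem mainTheorem3 (lam mu : ℝ) (hlm : lam * mu ≠ 0) (p q : ℝ≥0∞) (hp : 1 ≤ p) (hq : 1 ≤ q)
    (hp2 : p ≠ 2) (g g' : 𝓢(ℝ × ℝ, ℂ)) (hg : g ≠ 0) (hg' : g' ≠ 0) :
    -- (i)
    Coorbit.coorbit (Coorbit.rep619 lam mu) Coorbit.G619.sec g p ≠ Coorbit.modulationSpace g' q ∧
    -- (ii)
    Coorbit.coorbit (Coorbit.rep619 lam mu) Coorbit.G619.sec g p ≠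
      Coorbit.coorbit (Coorbit.rep53 1) Coorbit.G53.sec g' q ∧
    -- the one-parameter group acts by isometries on the second space
    (∀ u : ℝ, ∀ f ∈ Coorbit.coorbit (Coorbit.rep53 1) Coorbit.G53.sec g' q,
      Coorbit.distRep (Coorbit.rep53 1) ⟨0, 0, 0, u, 0⟩ f ∈
          Coorbit.coorbit (Coorbit.rep53 1) Coorbit.G53.sec g' q ∧
        Coorbit.coorbitNorm (Coorbit.rep53 1) Coorbit.G53.sec g' q
            (Coorbit.distRep (Coorbit.rep53 1) ⟨0, 0, 0, u, 0⟩ f) =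
          Coorbit.coorbitNorm (Coorbit.rep53 1) Coorbit.G53.sec g' q f) ∧
    -- the orbit of the Gaussian stays in the first space, with norm `≍ (1+u²)^{1/(2p)-1/4}`
    (∀ u : ℝ, Coorbit.distRep (Coorbit.rep53 1) ⟨0, 0, 0, u, 0⟩ (Coorbit.gaussian2 : 𝓢'(ℝ × ℝ, ℂ)) ∈
      Coorbit.coorbit (Coorbit.rep619 lam mu) Coorbit.G619.sec g p) ∧
    ∃ C : ℝ, 0 < C ∧ ∀ u : ℝ,
      C⁻¹ * (1 + u ^ 2) ^ ((p⁻¹).toReal / 2 - 1 / 4) ≤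
          Coorbit.coorbitNorm (Coorbit.rep619 lam mu) Coorbit.G619.sec g p
            (Coorbit.distRep (Coorbit.rep53 1) ⟨0, 0, 0, u, 0⟩
              (Coorbit.gaussian2 : 𝓢'(ℝ × ℝ, ℂ))) ∧
        Coorbit.coorbitNorm (Coorbit.rep619 lam mu) Coorbit.G619.sec g p
            (Coorbit.distRep (Coorbit.rep53 1) ⟨0, 0, 0, u, 0⟩
              (Coorbit.gaussian2 : 𝓢'(ℝ × ℝ, ℂ))) ≤
          C * (1 + u ^ 2) ^ ((p⁻¹).toReal / 2 - 1 / 4) := by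
  obtain ⟨A, B, hA0, hB0, hAB⟩ := Coorbit.exists_eLpNorm_coeff_chirpGaussian_bounds hlm hg
  -- The orbit of the Gaussian consists of the chirps with $a=0$ and $b=c=u$, so $M=1+u^2$.
  have hbound (u : ℝ) := hAB 0 u u p hp
  have h1 (u : ℝ) : (1 + (0 : ℝ) ^ 2) * (1 + u ^ 2) = 1 + u ^ 2 := by ring
  simp only [h1] at hbound
  refine ⟨Coorbit.coorbit_rep619_ne_modulationSpace hlm hp hq hp2 hg hg',
    Coorbit.coorbit_rep619_ne_coorbit_rep53 hlm hp hq hp2 hg hg', fun u f hf => ?_, fun u => ?_,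
    max A B⁻¹, lt_max_of_lt_left hA0, fun u => ?_⟩
  · have h := Coorbit.memLp_coeff_distRep_rep53 hf u
    exact ⟨h.1, congrArg ENNReal.toReal h.2⟩
  · rw [Coorbit.distRep_rep53_gaussian2]
    exact ⟨(hbound u).1, (hbound u).2.1.trans_lt ENNReal.ofReal_lt_top⟩
  · rw [Coorbit.distRep_rep53_gaussian2]
    have hpos : 0 < (1 + u ^ 2) ^ ((p⁻¹).toReal / 2 - 1 / 4) := by positivity
    have hfin := ((hbound u).2.1.trans_lt ENNReal.ofReal_lt_top).ne
    constructor
    · refine le_trans ?_ ((ENNReal.ofReal_le_iff_le_toReal hfin).1 (hbound u).2.2)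
      gcongr
      exact inv_le_of_inv_le₀ hB0 (le_max_right _ _)
    · refine (ENNReal.toReal_le_of_le_ofReal (by positivity) (hbound u).2.1).trans ?_
      gcongr
      exact le_max_left _ _
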